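/- Let $\mathbb{T}_2=\mathbb{R}^2/\mathbb{Z}^2$ be the unit torus with its flat metric $d_{\mathbb{T}_2}$ (for representatives in $[0,1)^2$, $d_{\mathbb{T}_2}(x,y)=\min\{\|x-y+(e_1,e_2)\| : e_1,e_2\in\{-1,0,1\}\}$, with $\|\cdot\|$ the Euclidean norm), and let $B_r(x)$ be the ball of radius $r$ around $x$ in this metric; it may be taken open throughout or closed throughout. Let $W$ be Brownian motion on $\mathbb{T}_2$, i.e. standard Brownian motion on $\mathbb{R}^2$ with both coordinates reduced modulo $1$; $\mathbb{E}_y$ denotes expectation when $W_0=y$, and $\tau_A=\inf\{t\ge 0: W_t\in A\}$. There exists a universal constant $C>0$ such that $$\left|\mathbb{E}_y[\tau_{B_r(x)}]-\frac1\pi\ln\frac{d_{\mathbb{T}_2}(x,y)}{r}\right|\le C$$ for all $x\in\mathbb{T}_2$, $r>0$ and $y\in\mathbb{T}_2\setminus B_r(x)$ (in particular the expectation is finite). Moreover, $$\mathbb{E}_y[\tau_{B_r(x)^c}]=\frac{r^2-d_{\mathbb{T}_2}(x,y)^2}{2}$$ for all $x\in\mathbb{T}_2$, $r\in(0,\tfrac12)$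 and $y\in B_r(x)$. -/

import Mathlib

open MeasureTheory ProbabilityTheory
open scoped NNReal ENNReal

universe u

noncomputable section

/-- The two-dimensional unit torus `(ℝ/ℤ)²`. As an `ℓ²` product of two circles of length one it
carries the flat metric, see `Torus.isLeast_dist_proj`. -/
abbrev Torus : Type := PiLp 2 (fun _ : Fin 2 => UnitAddCircle)

namespace Torus

/-- The projection `ℝ² → (ℝ/ℤ)²`, reducing each coordinate modulo one. -/
def proj (v : EuclideanSpace ℝ (Fin 2)) : Torus :=
  WithLp.toLp 2 (fun i => (v i : UnitAddCircle))

/-- For representatives in `[0,1)²`, the distance on the torus is the minimum of the Euclidean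
norms `‖v - w + (e₁, e₂)‖` with `e₁, e₂ ∈ {-1, 0, 1}`. -/
theorem isLeast_dist_proj (v w : EuclideanSpace ℝ (Fin 2))
    (hv : ∀ i, v i ∈ Set.Ico (0 : ℝ) 1) (hw : ∀ i, w i ∈ Set.Ico (0 : ℝ) 1) :
    IsLeast {a : ℝ | ∃ e : Fin 2 → ℝ, (∀ i, e i = -1 ∨ e i = 0 ∨ e i = 1) ∧
      a = ‖v - w + WithLp.toLp 2 e‖} (dist (proj v) (proj w)) := by
  have key : ∀ i, dist (v i : UnitAddCircle) (w i : UnitAddCircle)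
      = |v i - w i - round (v i - w i)| := by
    intro i
    rw [dist_eq_norm, ← AddCircle.coe_sub, UnitAddCircle.norm_eq]
  have hd : dist (proj v) (proj w)
      = Real.sqrt (∑ i, |v i - w i - round (v i - w i)| ^ 2) := by
    rw [PiLp.dist_eq_of_L2]
    simp only [proj, key]
  constructor
  · refine ⟨fun i => -(round (v i - w i) : ℝ), fun i => ?_, ?_⟩
    · have h1 := hv i
      have h2 := hw i
      have h3 := abs_le.1 (abs_sub_round (v i - w i))
      have h4 : (-2 : ℝ) < round (v i - w i) := by linarith [h1.1, h1.2, h2.1, h2.2, h3.1, h3.2]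
      have h5 : (round (v i - w i) : ℝ) < 2 := by linarith [h1.1, h1.2, h2.1, h2.2, h3.1, h3.2]
      have h6 : (-2 : ℤ) < round (v i - w i) := by exact_mod_cast h4
      have h7 : round (v i - w i) < (2 : ℤ) := by exact_mod_cast h5
      have h8 : round (v i - w i) = -1 ∨ round (v i - w i) = 0 ∨ round (v i - w i) = 1 := by
        omega
      rcases h8 with h | h | h <;> simp [h]
    · rw [hd, EuclideanSpace.norm_eq]
      simp [sub_eq_add_neg]
  · rintro a ⟨e, he, rfl⟩
    rw [hd, EuclideanSpace.norm_eq]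
    refine Real.sqrt_le_sqrt (Finset.sum_le_sum fun i _ => ?_)
    refine pow_le_pow_left₀ (abs_nonneg _) ?_ 2
    obtain ⟨k, hk⟩ : ∃ k : ℤ, e i = -(k : ℝ) := by
      rcases he i with h | h | h
      · exact ⟨1, by simp [h]⟩
      · exact ⟨0, by simp [h]⟩
      · exact ⟨-1, by simp [h]⟩
    have := round_le (v i - w i) k
    simpa [hk, sub_eq_add_neg] using this

end Torus

/-- `W` is a standard Brownian motion on `ℝ²` started at the origin: its coordinates are
independent standard real Brownian motions (Gaussian with the right finite-dimensional laws,
and with almost surely continuous paths). -/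
structure IsPlanarBrownian {Ω : Type u} [MeasurableSpace Ω]
    (W : ℝ≥0 → Ω → EuclideanSpace ℝ (Fin 2)) (P : Measure Ω) : Prop where
  isBrownianReal : ∀ i : Fin 2, IsBrownianReal (fun t ω => W t ω i) P
  indep : iIndepFun (fun (i : Fin 2) (ω : Ω) (t : ℝ≥0) => W t ω i) P

/-- Brownian motion on the torus started at `y`, driven by the planar Brownian motion `W`. -/
def torusBM {Ω : Type u} (W : ℝ≥0 → Ω → EuclideanSpace ℝ (Fin 2)) (y : Torus) :
    ℝ≥0 → Ω → Torus :=
  fun t ω => y + Torus.proj (W t ω)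

/-- The hitting time `inf {t ≥ 0 : X t ∈ A}` of `A` (infinite if there is no such `t`). -/
def hitTime {Ω : Type u} (X : ℝ≥0 → Ω → Torus) (A : Set Torus) : Ω → ℝ≥0∞ :=
  fun ω => ⨅ (t : ℝ≥0) (_ : X t ω ∈ A), (t : ℝ≥0∞)

end

/-! Lift to the plane: the distance from the torus process to `x` is `latticeDist` of a planar
Brownian path started at a lift `v` of `y - x` (`dist_torusBM`). Both claims thus concern mean entry
times `τ` of planar Brownian motion `Z` into a set `A`. If `Δg = 2` off `A`, Dynkin's formula `E
g(Z_τ) = g(v) + E τ` turns bounds on `g` into bounds on `E τ` (`lintegral_entryTime_bounds`).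

For hitting a ball, `g = -green`, where `green` is periodic and differs from `π⁻¹ log latticeDist`
by at most a constant `C`. Replacing `green` by the logarithm at the start and at the boundary costs
`C` each, so `E τ` is `π⁻¹ log (d / r)` up to `2C`. The function `green` is `π⁻¹ log ‖theta‖` plus a
quadratic in the imaginary part that restores periodicity. For leaving a ball, `g = ‖z‖² / 2` is
constant on the boundary and the answer is exact.

Dynkin's formula comes from random walks. The equation `Δg = 2` enters as circle averages `g z + ρ²
/ 2` for small `ρ`; mixing over radii, a Gaussian step of variance `δ` raises the mean of `g` by `δ
+ O(δ²)`. Over a grid of mesh `T / (n + 1)` the errors add up to `O(1 / n)`, and grid entry times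
into an open set converge to the true one. Closed target sets are then reached by approximation with
open ones. -/

noncomputable section

open Filter Topology

/-! ### Independence of past and increment for the planar process. -/

section Independence

/-- Both sides are the same fourfold integral once Tonelli exchanges the two middle variables. -/
theorem MeasureTheory.Measure.map_prod_prod_comm {α β γ δ : Type*} [MeasurableSpace α]
    [MeasurableSpace β] [MeasurableSpace γ] [MeasurableSpace δ] (μ : Measure α) (ν : Measure β)
    (ρ : Measure γ) (σ : Measure δ) [SFinite μ] [SFinite ν] [SFinite ρ] [SFinite σ] :
    ((μ.prod ν).prod (ρ.prod σ)).map (fun p => ((p.1.1, p.2.1), (p.1.2, p.2.2)))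
      = (μ.prod ρ).prod (ν.prod σ) := by
  refine Measure.ext_of_lintegral _ fun f hf => ?_
  rw [lintegral_map hf (by fun_prop), lintegral_prod _ (by fun_prop),
    lintegral_prod _ (by fun_prop), lintegral_prod _ (by fun_prop), lintegral_prod _ (by fun_prop)]
  refine lintegral_congr fun a => ?_
  have h1 : ∀ b : β, ∫⁻ y : γ × δ, f ((a, y.1), (b, y.2)) ∂ρ.prod σ
      = ∫⁻ c, ∫⁻ d, f ((a, c), (b, d)) ∂σ ∂ρ := fun b => lintegral_prod _ (by fun_prop)
  have h2 : ∀ c : γ, ∫⁻ y : β × δ, f ((a, c), y) ∂ν.prod σ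
      = ∫⁻ b, ∫⁻ d, f ((a, c), (b, d)) ∂σ ∂ν := fun b => lintegral_prod _ (by fun_prop)
  simp only [h1, h2]
  rw [lintegral_lintegral_swap]
  fun_prop

/-- With `Xᵢ` the past and `Dᵢ` the increment of coordinate `i`, this combines independence within
each coordinate and between the coordinates into independence of the planar past from the planar
increment. -/
theorem ProbabilityTheory.IndepFun.map_prodMk_prodMk {Ω α β γ δ : Type*}
    [MeasurableSpace Ω] {P : Measure Ω} [IsProbabilityMeasure P] [MeasurableSpace α]
    [MeasurableSpace β] [MeasurableSpace γ] [MeasurableSpace δ]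
    {X₀ : Ω → α} {D₀ : Ω → β} {X₁ : Ω → γ} {D₁ : Ω → δ}
    (hX₀ : AEMeasurable X₀ P) (hD₀ : AEMeasurable D₀ P) (hX₁ : AEMeasurable X₁ P)
    (hD₁ : AEMeasurable D₁ P) (h₀ : IndepFun X₀ D₀ P) (h₁ : IndepFun X₁ D₁ P)
    (h : IndepFun (fun ω => (X₀ ω, D₀ ω)) (fun ω => (X₁ ω, D₁ ω)) P) :
    P.map (fun ω => ((X₀ ω, X₁ ω), (D₀ ω, D₁ ω)))
      = (P.map (fun ω => (X₀ ω, X₁ ω))).prod ((P.map D₀).prod (P.map D₁)) := by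
  have e₀ := (indepFun_iff_map_prod_eq_prod_map_map hX₀ hD₀).1 h₀
  have e₁ := (indepFun_iff_map_prod_eq_prod_map_map hX₁ hD₁).1 h₁
  have e := (indepFun_iff_map_prod_eq_prod_map_map (hX₀.prodMk hD₀) (hX₁.prodMk hD₁)).1 h
  have e' := (indepFun_iff_map_prod_eq_prod_map_map hX₀ hX₁).1
    (h.comp measurable_fst measurable_fst)
  rw [e', ← Measure.map_prod_prod_comm, ← e₀, ← e₁, ← e, AEMeasurable.map_map_of_aemeasurable]
  · rfl
  · fun_prop
  · fun_prop

end Independence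

/-- The centred Gaussian measure on `ℂ` whose real and imaginary parts are independent with
variance `v`. -/
def complexGaussian (v : ℝ≥0) : Measure ℂ :=
  ((gaussianReal 0 v).prod (gaussianReal 0 v)).map Complex.measurableEquivRealProd.symm

instance (v : ℝ≥0) : IsProbabilityMeasure (complexGaussian v) := by
  unfold complexGaussian
  exact Measure.isProbabilityMeasure_map (by fun_prop)

/-- The planar process `v + W`, with the plane identified with `ℂ`. -/
def planarPath {Ω : Type u} (W : ℝ≥0 → Ω → EuclideanSpace ℝ (Fin 2)) (v : ℂ) (t : ℝ≥0) (ω : Ω) :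
    ℂ := v + ⟨W t ω 0, W t ω 1⟩

namespace IsPlanarBrownian

variable {Ω : Type u} [MeasurableSpace Ω] {P : Measure Ω}
  {W : ℝ≥0 → Ω → EuclideanSpace ℝ (Fin 2)}

theorem aemeasurable_planarPath (hW : IsPlanarBrownian W P) (v : ℂ) (t : ℝ≥0) :
    AEMeasurable (planarPath W v t) P := by
  have h0 := (hW.isBrownianReal 0).aemeasurable t
  have h1 := (hW.isBrownianReal 1).aemeasurable t
  have : planarPath W v t
      = fun ω => v + Complex.measurableEquivRealProd.symm (W t ω 0, W t ω 1) := rfl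
  rw [this]
  fun_prop

theorem ae_continuous_planarPath (hW : IsPlanarBrownian W P) (v : ℂ) :
    ∀ᵐ ω ∂P, Continuous (fun t => planarPath W v t ω) ∧ planarPath W v 0 ω = v := by
  filter_upwards [(hW.isBrownianReal 0).cont, (hW.isBrownianReal 1).cont,
    (hW.isBrownianReal 0).eval_zero_ae_eq_zero, (hW.isBrownianReal 1).eval_zero_ae_eq_zero]
    with ω h0 h1 h2 h3
  constructor
  · have h := (continuous_const (y := v)).add
      (Complex.equivRealProdCLM.symm.continuous.comp (h0.prodMk h1))
    refine h.congr fun t => ?_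
    apply Complex.ext <;> simp [planarPath]
  · apply Complex.ext <;> simp [planarPath, h2, h3]

/-- The increments of planar Brownian motion are Gaussian and independent of any finite part of
the past. -/
theorem map_past_increment [IsProbabilityMeasure P] (hW : IsPlanarBrownian W P) (v : ℂ) {n : ℕ} (s : Fin n → ℝ≥0)
    (t₀ δ : ℝ≥0) (hs : ∀ j, s j ≤ t₀) :
    P.map (fun ω => ((fun j => planarPath W v (s j) ω),
        planarPath W v (t₀ + δ) ω - planarPath W v t₀ ω))
      = (P.map (fun ω j => planarPath W v (s j) ω)).prod (complexGaussian δ) := by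
  have hm : ∀ i t, AEMeasurable (fun ω => W t ω i) P :=
    fun i t => (hW.isBrownianReal i).aemeasurable t
  let X : Fin 2 → Ω → Fin n → ℝ := fun i ω j => W (s j) ω i
  let D : Fin 2 → Ω → ℝ := fun i ω => W (t₀ + δ) ω i - W t₀ ω i
  have hX : ∀ i, AEMeasurable (X i) P := fun i => aemeasurable_pi_lambda _ fun j => hm i _
  have hD : ∀ i, AEMeasurable (D i) P := fun i => (hm i _).sub (hm i _)
  have hXD : ∀ i, IndepFun (X i) (D i) P := fun i =>
    ((hW.isBrownianReal i).indepFun_shift t₀).symm.comp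
      (φ := fun (p : Set.Iic t₀ → ℝ) (j : Fin n) => p ⟨s j, hs j⟩)
      (ψ := fun p : ℝ≥0 → ℝ => p δ) (by fun_prop) (measurable_pi_apply δ)
  have h01 : IndepFun (fun ω => (X 0 ω, D 0 ω)) (fun ω => (X 1 ω, D 1 ω)) P :=
    (hW.indep.indepFun (i := 0) (j := 1) (by decide)).comp
      (φ := fun p : ℝ≥0 → ℝ => ((fun j : Fin n => p (s j)), p (t₀ + δ) - p t₀))
      (ψ := fun p : ℝ≥0 → ℝ => ((fun j : Fin n => p (s j)), p (t₀ + δ) - p t₀))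
      (by fun_prop) (by fun_prop)
  have hlaw : ∀ i, P.map (D i) = gaussianReal 0 δ := fun i => by
    have := ((hW.isBrownianReal i).toIsPreBrownianReal.shift t₀).hasLaw_eval δ
    exact this.map_eq
  have key := IndepFun.map_prodMk_prodMk (hX 0) (hD 0) (hX 1) (hD 1) (hXD 0) (hXD 1) h01
  rw [hlaw, hlaw] at key
  let a : (Fin n → ℝ) × (Fin n → ℝ) → Fin n → ℂ := fun p j =>
    v + Complex.measurableEquivRealProd.symm (p.1 j, p.2 j)
  have ha : Measurable a := by fun_prop
  have e1 : P.map (fun ω j => planarPath W v (s j) ω)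
      = (P.map (fun ω => (X 0 ω, X 1 ω))).map a := by
    rw [AEMeasurable.map_map_of_aemeasurable ha.aemeasurable ((hX 0).prodMk (hX 1))]
    rfl
  rw [e1, complexGaussian, Measure.map_prod_map _ _ ha (MeasurableEquiv.measurable _), ← key,
    AEMeasurable.map_map_of_aemeasurable]
  · congr 1
    ext ω
    · rfl
    · apply Complex.ext <;> simp [planarPath, D]
  · exact (Measurable.prodMap ha (MeasurableEquiv.measurable _)).aemeasurable
  · exact ((hX 0).prodMk (hX 1)).prodMk ((hD 0).prodMk (hD 1))

end IsPlanarBrownian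

/-! ### Gaussian averages computed from circle averages. -/

section GaussianMean

theorem complexGaussian_eq_withDensity {v : ℝ≥0} (hv : v ≠ 0) :
    complexGaussian v = (volume : Measure ℂ).withDensity
      (fun z => gaussianPDF 0 v z.re * gaussianPDF 0 v z.im) := by
  have hm := measurable_gaussianPDF 0 v
  unfold complexGaussian
  rw [gaussianReal_of_var_ne_zero _ hv, prod_withDensity hm hm,
    ← (Complex.volume_preserving_equiv_real_prod.symm).map_eq]
  ext s hs
  rw [Measure.map_apply (MeasurableEquiv.measurable _) hs, withDensity_apply _ hs,
    withDensity_apply _ (MeasurableEquiv.measurable _ hs),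
    setLIntegral_map hs (by fun_prop) (MeasurableEquiv.measurable _)]
  rfl

theorem integral_complexGaussian {v : ℝ≥0} (hv : v ≠ 0) (k : ℂ → ℝ) :
    ∫ z, k z ∂complexGaussian v
      = ∫ z : ℂ, (2 * Real.pi * v)⁻¹ * Real.exp (-‖z‖ ^ 2 / (2 * v)) * k z := by
  have hm := measurable_gaussianPDF 0 v
  rw [complexGaussian_eq_withDensity hv, integral_withDensity_eq_integral_toReal_smul
    (by fun_prop) (ae_of_all _ fun z => ENNReal.mul_lt_top (by simp [gaussianPDF]) (by simp [gaussianPDF]))]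
  refine integral_congr_ae (ae_of_all _ fun z => ?_)
  have hv' : (0 : ℝ) < v := by positivity
  simp only [ENNReal.toReal_mul, toReal_gaussianPDF, gaussianPDFReal, smul_eq_mul, sub_zero]
  congr 1
  rw [mul_mul_mul_comm, ← mul_inv, ← Real.exp_add,
    Real.mul_self_sqrt (by positivity), ← Complex.normSq_eq_norm_sq, Complex.normSq_apply]
  congr 2
  ring

/-- A function whose averages over all circles around the origin vanish has mean zero under the
centred Gaussian. -/
theorem integral_complexGaussian_eq_zero {v : ℝ≥0} (hv : v ≠ 0) (k : ℂ → ℝ)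
    (hk : ∀ ρ : ℝ, 0 < ρ → Real.circleAverage k 0 ρ = 0) :
    ∫ z, k z ∂complexGaussian v = 0 := by
  rw [integral_complexGaussian hv, ← Complex.integral_comp_polarCoord_symm]
  set G : ℝ × ℝ → ℝ := fun p => p.1 • ((2 * Real.pi * v)⁻¹ *
      Real.exp (-‖Complex.polarCoord.symm p‖ ^ 2 / (2 * v)) * k (Complex.polarCoord.symm p)) with hG
  -- Fubini needs integrability; without it the Bochner integral is `0` by convention, so the claim
  -- still holds.
  by_cases hi : IntegrableOn G polarCoord.target (volume.prod volume)
  · rw [show polarCoord.target = Set.Ioi (0 : ℝ) ×ˢ Set.Ioo (-Real.pi) Real.pi from rfl] at hi ⊢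
    rw [Measure.volume_eq_prod, setIntegral_prod _ hi]
    refine setIntegral_eq_zero_of_forall_eq_zero fun ρ hρ => ?_
    have h1 : ∀ θ : ℝ, G (ρ, θ) = ρ * ((2 * Real.pi * v)⁻¹ *
        Real.exp (-ρ ^ 2 / (2 * v))) * k (circleMap 0 ρ θ) := by
      intro θ
      have : Complex.polarCoord.symm (ρ, θ) = circleMap 0 ρ θ := by
        simp [circleMap, Complex.exp_mul_I]
      simp only [hG, this, norm_circleMap_zero, sq_abs, smul_eq_mul]
      ring
    simp only [h1]
    rw [integral_const_mul]
    convert mul_zero _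
    have h2 := hk ρ hρ
    rw [Real.circleAverage_eq_integral_add (-Real.pi), smul_eq_mul,
      intervalIntegral.integral_comp_add_right (fun θ => k (circleMap 0 ρ θ))] at h2
    have h3 := (mul_eq_zero.1 h2).resolve_left (by positivity)
    rw [← integral_Ioc_eq_integral_Ioo, ← intervalIntegral.integral_of_le (by linarith [Real.pi_pos])]
    rw [← h3]
    congr 1 <;> ring
  · exact integral_undef hi

theorem integrable_pow_gaussianReal (v : ℝ≥0) (n : ℕ) :
    Integrable (fun x : ℝ => x ^ n) (gaussianReal 0 v) := by
  have := (memLp_id_gaussianReal (μ := 0) (v := v) (n : ℝ≥0))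
  have h := this.integrable_norm_pow'
  refine (integrable_norm_iff (by fun_prop)).1 ?_
  simpa using h

theorem integral_pow_four_gaussianReal (v : ℝ≥0) :
    ∫ x : ℝ, x ^ 4 ∂gaussianReal 0 v = (v : ℝ) ^ 2 * ∫ x : ℝ, x ^ 4 ∂gaussianReal 0 1 := by
  have h := gaussianReal_map_const_mul (μ := 0) (v := 1) (Real.sqrt v)
  have e : NNReal.mk (Real.sqrt v ^ 2) (sq_nonneg _) * 1 = v := by
    ext; simp
  rw [mul_zero, e] at h
  rw [← h, integral_map (by fun_prop) (by fun_prop), ← integral_const_mul]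
  refine integral_congr_ae (ae_of_all _ fun x => ?_)
  simp only [mul_pow]
  rw [show (4 : ℕ) = 2 * 2 from rfl, pow_mul, Real.sq_sqrt v.coe_nonneg]

theorem integrable_norm_pow_four_complexGaussian (v : ℝ≥0) :
    Integrable (fun z : ℂ => ‖z‖ ^ 4) (complexGaussian v) := by
  unfold complexGaussian
  rw [integrable_map_equiv]
  have h1 : Integrable (fun p : ℝ × ℝ => 2 * (p.1 ^ 4 + p.2 ^ 4))
      ((gaussianReal 0 v).prod (gaussianReal 0 v)) :=
    (((integrable_pow_gaussianReal v 4).comp_fst _).add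
      ((integrable_pow_gaussianReal v 4).comp_snd _)).const_mul 2
  refine h1.mono' (by fun_prop) (ae_of_all _ fun p => ?_)
  have : ‖Complex.measurableEquivRealProd.symm p‖ ^ 4 = (p.1 ^ 2 + p.2 ^ 2) ^ 2 := by
    rw [show (4 : ℕ) = 2 * 2 from rfl, pow_mul, ← Complex.normSq_eq_norm_sq, Complex.normSq_apply]
    simp; ring
  simp only [Function.comp, this, Real.norm_eq_abs]
  rw [abs_of_nonneg (by positivity)]
  nlinarith [sq_nonneg (p.1 ^ 2 - p.2 ^ 2)]

/-- From `(a² + b²)² ≤ 2(a⁴ + b⁴)` and scaling. The order `v²` is what makes the accumulated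
one-step errors vanish as the grid is refined. -/
theorem integral_norm_pow_four_complexGaussian_le (v : ℝ≥0) :
    ∫ z : ℂ, ‖z‖ ^ 4 ∂complexGaussian v
      ≤ (4 * ∫ x : ℝ, x ^ 4 ∂gaussianReal 0 1) * (v : ℝ) ^ 2 := by
  have h0 := integrable_norm_pow_four_complexGaussian v
  unfold complexGaussian at h0 ⊢
  rw [integrable_map_equiv] at h0
  rw [integral_map_equiv]
  have i1 := (integrable_pow_gaussianReal v 4).comp_fst (gaussianReal 0 v)
  have i2 := (integrable_pow_gaussianReal v 4).comp_snd (gaussianReal 0 v)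
  have h1 : Integrable (fun p : ℝ × ℝ => 2 * (p.1 ^ 4 + p.2 ^ 4))
      ((gaussianReal 0 v).prod (gaussianReal 0 v)) := (i1.add i2).const_mul 2
  have h2 := integral_mono h0 h1 fun p => by
    have : ‖Complex.measurableEquivRealProd.symm p‖ ^ 4 = (p.1 ^ 2 + p.2 ^ 2) ^ 2 := by
      rw [show (4 : ℕ) = 2 * 2 from rfl, pow_mul, ← Complex.normSq_eq_norm_sq, Complex.normSq_apply]
      simp; ring
    simp only [Function.comp, this]
    nlinarith [sq_nonneg (p.1 ^ 2 - p.2 ^ 2)]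
  refine h2.trans (le_of_eq ?_)
  rw [integral_const_mul, integral_add i1 i2, integral_fun_fst (fun x : ℝ => x ^ 4),
    integral_fun_snd (fun x : ℝ => x ^ 4), integral_pow_four_gaussianReal]
  simp
  ring

theorem integral_norm_sq_complexGaussian (v : ℝ≥0) :
    ∫ z : ℂ, ‖z‖ ^ 2 ∂complexGaussian v = 2 * v := by
  have h2 : ∫ x : ℝ, x ^ 2 ∂gaussianReal 0 v = v := by
    have := variance_id_gaussianReal (μ := 0) (v := v)
    rwa [variance_of_integral_eq_zero (by fun_prop) (by simp)] at this
  unfold complexGaussian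
  rw [integral_map_equiv]
  have i1 := (integrable_pow_gaussianReal v 2).comp_fst (gaussianReal 0 v)
  have i2 := (integrable_pow_gaussianReal v 2).comp_snd (gaussianReal 0 v)
  have : ∀ p : ℝ × ℝ, ‖Complex.measurableEquivRealProd.symm p‖ ^ 2 = p.1 ^ 2 + p.2 ^ 2 := by
    intro p
    rw [← Complex.normSq_eq_norm_sq, Complex.normSq_apply]
    simp; ring
  simp only [this]
  rw [integral_add i1 i2, integral_fun_fst (fun x : ℝ => x ^ 2),
    integral_fun_snd (fun x : ℝ => x ^ 2), h2]
  simp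
  ring

theorem circleIntegrable_of_measurable_of_bound {f : ℂ → ℝ} (hf : Measurable f) {M : ℝ}
    (hM : ∀ z, |f z| ≤ M) (c : ℂ) (ρ : ℝ) : CircleIntegrable f c ρ := by
  refine Measure.integrableOn_of_bounded (M := M) ?_ ?_ (ae_of_all _ fun θ => hM _) |> fun h =>
    (intervalIntegrable_iff.2 h)
  · simp [ENNReal.mul_eq_top]
  · exact (hf.comp (measurable_circleMap c ρ)).aestronglyMeasurable

/-- If the circle averages of `f` around `z` grow like `ρ² / 2` for small radii, the Gaussian
average of variance `v` exceeds `f z` by `v` up to an error `O(v²)`. -/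
theorem exists_abs_integral_complexGaussian_sub_le (M ρ₀ : ℝ) (hρ₀ : 0 < ρ₀) (hM0 : 0 ≤ M) :
    ∃ K : ℝ, 0 ≤ K ∧ ∀ (f : ℂ → ℝ) (_ : Measurable f) (_ : ∀ z, |f z| ≤ M) (z : ℂ)
      (_ : ∀ ρ, 0 < ρ → ρ < ρ₀ → Real.circleAverage f z ρ = f z + ρ ^ 2 / 2)
      (v : ℝ≥0) (_ : v ≠ 0),
      |(∫ u, f (z + u) ∂complexGaussian v) - f z - v| ≤ K * (v : ℝ) ^ 2 := by
  -- Outside the ball of radius `ρ₀` the error is at most `2M + ‖u‖² / 2`; each term is a multiple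
  -- of `‖u‖⁴` there because `‖u‖ ≥ ρ₀`.
  set K₁ : ℝ := 2 * M / ρ₀ ^ 4 + 1 / (2 * ρ₀ ^ 2)
  have hK₁ : 0 ≤ K₁ := by positivity
  refine ⟨K₁ * (4 * ∫ x : ℝ, x ^ 4 ∂gaussianReal 0 1), mul_nonneg hK₁ (mul_nonneg (by norm_num)
    (integral_nonneg fun x => by positivity)), fun f hf hM z hz v hv => ?_⟩
  set γ := complexGaussian v
  have i4 := integrable_norm_pow_four_complexGaussian v
  have i2 : Integrable (fun u : ℂ => ‖u‖ ^ 2) γ :=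
    ((integrable_const (1 : ℝ)).add i4).mono' (by fun_prop) (ae_of_all _ fun u => by
      simp only [Pi.add_apply, Real.norm_eq_abs]
      rw [abs_of_nonneg (by positivity)]
      nlinarith [sq_nonneg (‖u‖ ^ 2 - 1)])
  have i0 : Integrable (fun u => f (z + u)) γ :=
    Integrable.of_bound (hf.comp (measurable_const_add z)).aestronglyMeasurable M (ae_of_all _ fun u => hM _)
  -- The subtracted quadratic has Gaussian mean `v`, and makes the averages of `g` vanish on circles
  -- around `0` of radius below `ρ₀`. Only the tail outside `B` contributes.
  set g : ℂ → ℝ := fun u => f (z + u) - f z - ‖u‖ ^ 2 / 2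
  have ig : Integrable g γ := (i0.sub (integrable_const _)).sub (i2.div_const 2)
  have hg : ∫ u, g u ∂γ = (∫ u, f (z + u) ∂γ) - f z - v := by
    have a1 : ∫ u, g u ∂γ = ∫ u, (f (z + u) - f z) ∂γ - ∫ u, ‖u‖ ^ 2 / 2 ∂γ :=
      integral_sub (i0.sub (integrable_const _)) (i2.div_const 2)
    rw [a1, integral_sub i0 (integrable_const _), integral_div, integral_norm_sq_complexGaussian]
    simp
  set B := Metric.ball (0 : ℂ) ρ₀
  have hB : MeasurableSet B := measurableSet_ball
  have hin : ∫ u, B.indicator g u ∂γ = 0 := by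
    refine integral_complexGaussian_eq_zero hv _ fun ρ hρ => ?_
    by_cases hρ' : ρ < ρ₀
    · have e1 : Real.circleAverage (B.indicator g) 0 ρ
          = Real.circleAverage ((fun u => f (u + z)) - fun _ => (f z + ρ ^ 2 / 2)) 0 ρ := by
        refine Real.circleAverage_congr_sphere fun u hu => ?_
        have hu' : ‖u‖ = ρ := by simpa [abs_of_pos hρ] using hu
        rw [Set.indicator_of_mem (by simpa [B, hu'] using hρ')]
        simp only [g, hu', Pi.sub_apply, add_comm z]
        ring
      rw [e1, Real.circleAverage_sub, Real.circleAverage_map_add_const, hz ρ hρ hρ',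
        Real.circleAverage_const, sub_self]
      · exact circleIntegrable_of_measurable_of_bound (by fun_prop) (fun u => hM _) _ _
      · exact circleIntegrable_of_measurable_of_bound (by fun_prop) (fun u => le_rfl) _ _
    · have e1 : Real.circleAverage (B.indicator g) 0 ρ
          = Real.circleAverage (fun _ => (0 : ℝ)) 0 ρ := by
        refine Real.circleAverage_congr_sphere fun u hu => ?_
        have hu' : ‖u‖ = ρ := by simpa [abs_of_pos hρ] using hu
        exact Set.indicator_of_notMem (by simpa [B, hu'] using hρ') _
      rw [e1, Real.circleAverage_const]
  have hsplit : ∫ u, g u ∂γ = ∫ u, Bᶜ.indicator g u ∂γ := by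
    rw [← zero_add (∫ u, Bᶜ.indicator g u ∂γ), ← hin,
      ← integral_add (ig.indicator hB) (ig.indicator hB.compl)]
    exact integral_congr_ae (ae_of_all _ fun u => (Set.indicator_self_add_compl_apply B g u).symm)
  rw [← hg, hsplit, ← Real.norm_eq_abs]
  have hb : ∀ u, ‖Bᶜ.indicator g u‖ ≤ K₁ * ‖u‖ ^ 4 := by
    intro u
    by_cases hu : u ∈ Bᶜ
    · rw [Set.indicator_of_mem hu, Real.norm_eq_abs]
      have hu' : ρ₀ ≤ ‖u‖ := by simpa [B] using hu
      have h1 : |g u| ≤ 2 * M + ‖u‖ ^ 2 / 2 := by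
        have a1 := abs_le.1 (hM (z + u))
        have a2 := abs_le.1 (hM z)
        have a3 : 0 ≤ ‖u‖ ^ 2 / 2 := by positivity
        rw [abs_le]
        constructor <;> simp only [g] <;> linarith [a1.1, a1.2, a2.1, a2.2]
      have h2 : 2 * M ≤ 2 * M / ρ₀ ^ 4 * ‖u‖ ^ 4 := by
        rw [div_mul_eq_mul_div, le_div_iff₀ (by positivity)]
        gcongr
      have h3 : ‖u‖ ^ 2 / 2 ≤ 1 / (2 * ρ₀ ^ 2) * ‖u‖ ^ 4 := by
        rw [div_mul_eq_mul_div, le_div_iff₀ (by positivity)]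
        have : ρ₀ ^ 2 ≤ ‖u‖ ^ 2 := by gcongr
        nlinarith [sq_nonneg ‖u‖]
      calc |g u| ≤ _ := h1
        _ ≤ _ := by rw [add_mul]; linarith
    · rw [Set.indicator_of_notMem hu]
      simp only [norm_zero]; positivity
  calc ‖∫ u, Bᶜ.indicator g u ∂γ‖ ≤ ∫ u, K₁ * ‖u‖ ^ 4 ∂γ :=
        norm_integral_le_of_norm_le (i4.const_mul _) (ae_of_all _ hb)
    _ ≤ _ := by
        rw [integral_const_mul, mul_assoc]
        exact mul_le_mul_of_nonneg_left (integral_norm_pow_four_complexGaussian_le v) hK₁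

end GaussianMean

/-! ### Entry index of a discrete path. -/

section EntryIndex

open Classical in
/-- The first index `j < K` with `S j ∈ A`, or `K` if there is none. -/
def entryIndex (A : Set ℂ) (S : ℕ → ℂ) : ℕ → ℕ
  | 0 => 0
  | K + 1 => entryIndex A S K + if ∀ j ≤ K, S j ∉ A then 1 else 0

variable {A : Set ℂ} {S : ℕ → ℂ}

theorem entryIndex_le (K : ℕ) : entryIndex A S K ≤ K := by
  induction K with
  | zero => exact le_rfl
  | succ K ih => rw [entryIndex]; split_ifs <;> omega

theorem entryIndex_eq_self {K : ℕ} (h : ∀ j < K, S j ∉ A) : entryIndex A S K = K := by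
  induction K with
  | zero => rfl
  | succ K ih =>
    rw [entryIndex, ih fun j hj => h j (by omega), if_pos fun j hj => h j (by omega)]

theorem notMem_of_lt_entryIndex {K j : ℕ} (h : j < entryIndex A S K) : S j ∉ A := by
  induction K with
  | zero => exact absurd h (Nat.not_lt_zero _)
  | succ K ih =>
    rw [entryIndex] at h
    split_ifs at h with hK
    · exact hK j (by have := entryIndex_le (A := A) (S := S) K; omega)
    · exact ih h

theorem mem_of_entryIndex_lt {K : ℕ} (h : entryIndex A S K < K) : S (entryIndex A S K) ∈ A := by
  induction K with
  | zero => exact absurd h (Nat.not_lt_zero _)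
  | succ K ih =>
    rw [entryIndex] at h ⊢
    split_ifs at h ⊢ with hK
    · rw [entryIndex_eq_self fun j hj => hK j hj.le] at h
      omega
    · rw [add_zero] at h ⊢
      rcases (entryIndex_le (A := A) (S := S) K).lt_or_eq with h1 | h1
      · exact ih h1
      · rw [h1]
        by_contra h2
        refine hK fun j hj => ?_
        rcases hj.lt_or_eq with h3 | rfl
        · exact notMem_of_lt_entryIndex (K := K) (by omega)
        · exact h2

open Classical in
theorem apply_entryIndex_succ (f : ℂ → ℝ) (K : ℕ) :
    f (S (entryIndex A S (K + 1))) = f (S (entryIndex A S K))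
      + if ∀ j ≤ K, S j ∉ A then f (S (K + 1)) - f (S K) else 0 := by
  rw [entryIndex]
  split_ifs with h
  · rw [entryIndex_eq_self fun j hj => h j hj.le]; ring
  · simp

end EntryIndex

/-! ### Dynkin's formula for random walks. -/

section DiscreteDynkin

variable {Ω : Type u} [MeasurableSpace Ω] {P : Measure Ω} [IsProbabilityMeasure P]

-- Not having entered `A` by step `K` is an event of the past, and the next increment is independent
-- of the past with law `γ`. Integrating out the increment first leaves `hmean` at the current
-- position, which lies outside `A` on that event.
open Classical in
theorem integral_alive_increment {S : ℕ → Ω → ℂ} (hS : ∀ n, AEMeasurable (S n) P)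
    {γ : Measure ℂ} [IsProbabilityMeasure γ] {K : ℕ}
    (hγ : P.map (fun ω => ((fun j : Fin (K + 1) => S j ω), S (K + 1) ω - S K ω))
      = (P.map (fun ω (j : Fin (K + 1)) => S j ω)).prod γ)
    {A : Set ℂ} (hA : MeasurableSet A) {f : ℂ → ℝ} (hf : Measurable f) {M : ℝ}
    (hM : ∀ z, |f z| ≤ M) {δ η : ℝ} (hη : 0 ≤ η)
    (hmean : ∀ z ∉ A, |(∫ u, f (z + u) ∂γ) - f z - δ| ≤ η) :
    Integrable (fun ω => if ∀ j ≤ K, S j ω ∉ A then f (S (K + 1) ω) - f (S K ω) else 0) P ∧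
    Integrable (fun ω => if ∀ j ≤ K, S j ω ∉ A then (1 : ℝ) else 0) P ∧
    |(∫ ω, if ∀ j ≤ K, S j ω ∉ A then f (S (K + 1) ω) - f (S K ω) else 0 ∂P)
      - δ * ∫ ω, (if ∀ j ≤ K, S j ω ∉ A then (1 : ℝ) else 0) ∂P| ≤ η := by
  set V : Ω → Fin (K + 1) → ℂ := fun ω j => S j ω
  have hV : AEMeasurable V P := aemeasurable_pi_lambda _ fun j => hS _
  set C : Set (Fin (K + 1) → ℂ) := {v | ∀ j, v j ∉ A}
  have hC : MeasurableSet C := by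
    have : C = ⋂ j, (fun v : Fin (K + 1) → ℂ => v j) ⁻¹' Aᶜ := by
      ext v; simp [C]
    rw [this]
    exact MeasurableSet.iInter fun j => measurable_pi_apply j hA.compl
  have hiff : ∀ ω, (∀ j ≤ K, S j ω ∉ A) ↔ V ω ∈ C := fun ω =>
    ⟨fun h j => h j (Nat.lt_succ_iff.1 j.2), fun h j hj => h ⟨j, Nat.lt_succ_iff.2 hj⟩⟩
  set D : Ω → ℂ := fun ω => S (K + 1) ω - S K ω
  have hD : AEMeasurable D P := (hS _).sub (hS _)
  set G : (Fin (K + 1) → ℂ) × ℂ → ℝ := fun p =>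
    C.indicator (fun _ => (1 : ℝ)) p.1 * (f (p.1 (Fin.last K) + p.2) - f (p.1 (Fin.last K)))
  have hc : Measurable (C.indicator (fun _ => (1 : ℝ))) := measurable_const.indicator hC
  have hG : Measurable G := by
    have h1 : Measurable fun p : (Fin (K + 1) → ℂ) × ℂ => p.1 (Fin.last K) := by fun_prop
    exact (hc.comp measurable_fst).mul ((hf.comp (h1.add measurable_snd)).sub (hf.comp h1))
  have hGb : ∀ p, ‖G p‖ ≤ 2 * M := fun p => by
    have h1 : ‖f (p.1 (Fin.last K) + p.2) - f (p.1 (Fin.last K))‖ ≤ 2 * M := by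
      have := norm_sub_le (f (p.1 (Fin.last K) + p.2)) (f (p.1 (Fin.last K)))
      have h2 := hM (p.1 (Fin.last K) + p.2)
      have h3 := hM (p.1 (Fin.last K))
      simp only [Real.norm_eq_abs] at this ⊢
      linarith
    simp only [G, Set.indicator]
    split_ifs
    · simpa using h1
    · simpa using (norm_nonneg _).trans h1
  have eG : (fun ω => if ∀ j ≤ K, S j ω ∉ A then f (S (K + 1) ω) - f (S K ω) else 0)
      = fun ω => G (V ω, D ω) := by
    ext ω
    by_cases h : V ω ∈ C
    · rw [if_pos ((hiff ω).2 h)]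
      simp [G, h, V, D]
    · rw [if_neg (mt (hiff ω).1 h)]
      simp [G, h]
  have e1 : (fun ω => if ∀ j ≤ K, S j ω ∉ A then (1 : ℝ) else 0)
      = fun ω => C.indicator (fun _ => (1 : ℝ)) (V ω) := by
    ext ω
    by_cases h : V ω ∈ C
    · rw [if_pos ((hiff ω).2 h)]; simp [h]
    · rw [if_neg (mt (hiff ω).1 h)]; simp [h]
  have iG : Integrable (fun ω => G (V ω, D ω)) P :=
    Integrable.of_bound (hG.comp_aemeasurable (hV.prodMk hD)).aestronglyMeasurable (2 * M)
      (ae_of_all _ fun ω => hGb _)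
  have i1 : Integrable (fun ω => C.indicator (fun _ => (1 : ℝ)) (V ω)) P :=
    Integrable.of_bound (hc.comp_aemeasurable hV).aestronglyMeasurable 1
      (ae_of_all _ fun ω => by simp only [Set.indicator]; split_ifs <;> simp)
  rw [eG, e1]
  refine ⟨iG, i1, ?_⟩
  set μ := P.map V
  have : IsProbabilityMeasure μ := Measure.isProbabilityMeasure_map hV
  have iG' : Integrable G (μ.prod γ) :=
    Integrable.of_bound hG.aestronglyMeasurable (2 * M) (ae_of_all _ hGb)
  have i1' : Integrable (C.indicator (fun _ => (1 : ℝ))) μ :=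
    (integrable_const _).indicator hC
  have a1 : ∫ ω, G (V ω, D ω) ∂P = ∫ v, ∫ u, G (v, u) ∂γ ∂μ := by
    rw [← integral_prod _ iG', ← hγ, integral_map (hV.prodMk hD) hG.aestronglyMeasurable]
  have a2 : ∫ ω, C.indicator (fun _ => (1 : ℝ)) (V ω) ∂P
      = ∫ v, C.indicator (fun _ => (1 : ℝ)) v ∂μ :=
    (integral_map hV hc.aestronglyMeasurable).symm
  rw [a1, a2, ← integral_const_mul, ← integral_sub iG'.integral_prod_left (i1'.const_mul δ),
    ← Real.norm_eq_abs]
  have hb : ∀ v, ‖(∫ u, G (v, u) ∂γ) - δ * C.indicator (fun _ => (1 : ℝ)) v‖ ≤ η := by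
    intro v
    by_cases h : v ∈ C
    · have i0 : Integrable (fun u => f (v (Fin.last K) + u)) γ :=
        Integrable.of_bound (hf.comp (measurable_const_add _)).aestronglyMeasurable M
          (ae_of_all _ fun u => hM _)
      simp only [G, Set.indicator_of_mem h, one_mul, mul_one]
      rw [integral_sub i0 (integrable_const _), integral_const, probReal_univ, one_smul]
      exact hmean _ (h _)
    · simpa [G, h] using hη
  have := norm_integral_le_of_norm_le_const (μ := μ) (ae_of_all _ hb)
  simpa using this

/-- The discrete Dynkin formula, with an error for each step of the walk. -/
theorem abs_integral_entryIndex_sub_le {S : ℕ → Ω → ℂ} (hS : ∀ n, AEMeasurable (S n) P)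
    {γ : Measure ℂ} [IsProbabilityMeasure γ]
    (hγ : ∀ K, P.map (fun ω => ((fun j : Fin (K + 1) => S j ω), S (K + 1) ω - S K ω))
      = (P.map (fun ω (j : Fin (K + 1)) => S j ω)).prod γ)
    {A : Set ℂ} (hA : MeasurableSet A) {f : ℂ → ℝ} (hf : Measurable f) {M : ℝ}
    (hM : ∀ z, |f z| ≤ M) {δ η : ℝ} (hη : 0 ≤ η)
    (hmean : ∀ z ∉ A, |(∫ u, f (z + u) ∂γ) - f z - δ| ≤ η) (K : ℕ) :
    Integrable (fun ω => f (S (entryIndex A (fun n => S n ω) K) ω)) P ∧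
    Integrable (fun ω => (entryIndex A (fun n => S n ω) K : ℝ)) P ∧
    |(∫ ω, f (S (entryIndex A (fun n => S n ω) K) ω) ∂P) - (∫ ω, f (S 0 ω) ∂P)
      - δ * ∫ ω, (entryIndex A (fun n => S n ω) K : ℝ) ∂P| ≤ K * η := by
  classical
  induction K with
  | zero =>
    refine ⟨?_, ?_, ?_⟩
    · exact Integrable.of_bound (hf.comp_aemeasurable (hS 0)).aestronglyMeasurable M
        (ae_of_all _ fun ω => hM _)
    · simp [entryIndex]
    · simp [entryIndex]
  | succ K ih =>
    obtain ⟨h1, h2, h3⟩ := ih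
    obtain ⟨g1, g2, g3⟩ := integral_alive_increment hS (hγ K) hA hf hM hη hmean
    have e1 : ∀ ω, f (S (entryIndex A (fun n => S n ω) (K + 1)) ω)
        = f (S (entryIndex A (fun n => S n ω) K) ω)
          + if ∀ j ≤ K, S j ω ∉ A then f (S (K + 1) ω) - f (S K ω) else 0 := fun ω =>
      apply_entryIndex_succ (S := fun n => S n ω) f K
    have e2 : ∀ ω, (entryIndex A (fun n => S n ω) (K + 1) : ℝ)
        = (entryIndex A (fun n => S n ω) K : ℝ)
          + if ∀ j ≤ K, S j ω ∉ A then (1 : ℝ) else 0 := fun ω => by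
      rw [entryIndex]; push_cast; rfl
    simp only [e1, e2]
    refine ⟨h1.add g1, h2.add g2, ?_⟩
    rw [integral_add h1 g1, integral_add h2 g2]
    push_cast
    rw [abs_le] at h3 g3 ⊢
    constructor <;> linarith [h3.1, h3.2, g3.1, g3.2]

end DiscreteDynkin

/-! ### Entry times of continuous paths. -/

section EntryTime

/-- The first time the path `Z` is in `A`. -/
def entryTime {E : Type*} (Z : ℝ≥0 → E) (A : Set E) : ℝ≥0∞ :=
  ⨅ (t : ℝ≥0) (_ : Z t ∈ A), (t : ℝ≥0∞)

/-- The entry time truncated at `T`. -/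
def truncEntryTime {E : Type*} (Z : ℝ≥0 → E) (A : Set E) (T : ℝ≥0) : ℝ≥0 :=
  (min (entryTime Z A) T).toNNReal

variable {E : Type*} {Z : ℝ≥0 → E} {A : Set E} {T : ℝ≥0}

theorem entryTime_le {t : ℝ≥0} (h : Z t ∈ A) : entryTime Z A ≤ t := iInf₂_le t h

theorem exists_mem_of_entryTime_lt {a : ℝ≥0∞} (h : entryTime Z A < a) :
    ∃ t : ℝ≥0, Z t ∈ A ∧ (t : ℝ≥0∞) < a := by
  simpa [entryTime, iInf_lt_iff] using h

theorem entryTime_anti {B : Set E} (h : A ⊆ B) : entryTime Z B ≤ entryTime Z A :=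
  le_iInf₂ fun _ ht => entryTime_le (h ht)

theorem coe_truncEntryTime : (truncEntryTime Z A T : ℝ≥0∞) = min (entryTime Z A) T :=
  ENNReal.coe_toNNReal (ne_top_of_le_ne_top ENNReal.coe_ne_top (min_le_right _ _))

theorem truncEntryTime_le : truncEntryTime Z A T ≤ T := by
  rw [← ENNReal.coe_le_coe, coe_truncEntryTime]; exact min_le_right _ _

theorem truncEntryTime_eq_of_le (h : T ≤ entryTime Z A) : truncEntryTime Z A T = T := by
  rw [truncEntryTime, min_eq_right h, ENNReal.toNNReal_coe]

theorem iSup_min_natCast (a : ℝ≥0∞) : ⨆ n : ℕ, min a ((n : ℝ≥0) : ℝ≥0∞) = a := by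
  rw [← inf_iSup_eq]
  simp [ENNReal.iSup_natCast]

variable [TopologicalSpace E]

/-- A path inside an open set at a positive time was already inside slightly earlier, contradicting
minimality; time `0` is excluded by `h0`. -/
theorem apply_truncEntryTime_notMem (hZ : Continuous Z) (hA : IsOpen A) (h0 : Z 0 ∉ A) :
    Z (truncEntryTime Z A T) ∉ A := by
  set σ := truncEntryTime Z A T with hσ
  intro h
  have hpos : 0 < σ := by
    rw [pos_iff_ne_zero]
    intro h'
    rw [h'] at h
    exact h0 h
  obtain ⟨l, hl, hl'⟩ := exists_Ioc_subset_of_mem_nhds ((hA.preimage hZ).mem_nhds h) ⟨0, hpos⟩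
  obtain ⟨s, hs1, hs2⟩ := exists_between hl
  have h1 : entryTime Z A ≤ s := entryTime_le (hl' ⟨hs1, hs2.le⟩)
  have h2 : (σ : ℝ≥0∞) ≤ entryTime Z A := by rw [hσ, coe_truncEntryTime]; exact min_le_left _ _
  exact absurd (ENNReal.coe_le_coe.1 (h2.trans h1)) (not_le.2 hs2)

/-- A path outside `closure A` stays outside for a while, so the infimum of its visits could not be
the present time. -/
theorem apply_truncEntryTime_mem_closure (hZ : Continuous Z) (h : entryTime Z A < T) :
    Z (truncEntryTime Z A T) ∈ closure A := by
  set σ := truncEntryTime Z A T with hσ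
  have h1 : (σ : ℝ≥0∞) = entryTime Z A := by rw [hσ, coe_truncEntryTime, min_eq_left h.le]
  by_contra hc
  obtain ⟨u, hu, hu'⟩ := exists_Ico_subset_of_mem_nhds
    ((isClosed_closure.isOpen_compl.preimage hZ).mem_nhds hc) ⟨σ + 1, by simp⟩
  have h2 : (u : ℝ≥0∞) ≤ entryTime Z A := by
    refine le_iInf₂ fun t ht => ?_
    have h3 : σ ≤ t := by rw [← ENNReal.coe_le_coe, h1]; exact entryTime_le ht
    rw [ENNReal.coe_le_coe]
    by_contra h4
    exact hu' ⟨h3, not_le.1 h4⟩ (subset_closure ht)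
  rw [← h1, ENNReal.coe_le_coe] at h2
  exact absurd h2 (not_le.2 hu)

end EntryTime

/-! ### Approximation of entry times along grids. -/

section Grid

/-- The truncated entry time is the limit of the entry times along finer and finer grids. -/
theorem tendsto_entryIndex_mul {Z : ℝ≥0 → ℂ} {A : Set ℂ} (hZ : Continuous Z) (hA : IsOpen A)
    (T : ℝ≥0) :
    Tendsto (fun n : ℕ => (entryIndex A (fun j => Z (j * (T / (n + 1 : ℕ)))) (n + 1) : ℝ≥0)
      * (T / (n + 1 : ℕ))) atTop (𝓝 (truncEntryTime Z A T)) := by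
  set σ := truncEntryTime Z A T with hσ
  have hδ : Tendsto (fun n : ℕ => T / ((n + 1 : ℕ) : ℝ≥0)) atTop (𝓝 0) :=
    (tendsto_const_div_atTop_nhds_zero_nat T).comp (tendsto_add_atTop_nat 1)
  have hle : ∀ n : ℕ, (entryIndex A (fun j => Z (j * (T / (n + 1 : ℕ)))) (n + 1) : ℝ≥0)
      * (T / (n + 1 : ℕ)) ≤ T := fun n => by
    have h1 := entryIndex_le (A := A) (S := fun j => Z (j * (T / (n + 1 : ℕ)))) (n + 1)
    calc _ ≤ ((n + 1 : ℕ) : ℝ≥0) * (T / (n + 1 : ℕ)) := by gcongr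
      _ = T := mul_div_cancel₀ _ (by positivity)
  refine tendsto_order.2 ⟨fun a ha => Eventually.of_forall fun n => ha.trans_le ?_, fun s hs => ?_⟩
  -- Grid times never undershoot: an entry on the grid is a genuine visit, and no entry yields the
  -- value `T`.
  · rcases (entryIndex_le (A := A) (S := fun j => Z (j * (T / (n + 1 : ℕ)))) (n + 1)).lt_or_eq
      with h | h
    · rw [← ENNReal.coe_le_coe, hσ, coe_truncEntryTime]
      exact (min_le_left _ _).trans (entryTime_le (mem_of_entryIndex_lt h))
    · rw [h, mul_div_cancel₀ _ (by positivity)]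
      exact truncEntryTime_le
  · rcases le_or_gt (T : ℝ≥0∞) (entryTime Z A) with h | h
    · rw [truncEntryTime_eq_of_le h] at hσ
      rw [hσ] at hs
      exact Eventually.of_forall fun n => (hle n).trans_lt hs
    · have h1 : (σ : ℝ≥0∞) = entryTime Z A := by rw [hσ, coe_truncEntryTime, min_eq_left h.le]
      obtain ⟨t, htA, hts⟩ := exists_mem_of_entryTime_lt (a := (s : ℝ≥0∞))
        (by rw [← h1]; exact ENNReal.coe_lt_coe.2 hs)
      rw [ENNReal.coe_lt_coe] at hts
      -- As `A` is open, the visit at time `t` lasts through `[t, u)`, and a fine grid has a point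
      -- there before `s`.
      obtain ⟨u, hu, hu'⟩ := exists_Ico_subset_of_mem_nhds
        ((hA.preimage hZ).mem_nhds htA) ⟨s, hts⟩
      have hTpos : 0 < T := by
        rw [pos_iff_ne_zero]; rintro rfl; simp at h
      have hw : 0 < min u s - t := tsub_pos_of_lt (lt_min hu hts)
      filter_upwards [hδ.eventually (gt_mem_nhds hw)] with n hn
      set δ := T / ((n + 1 : ℕ) : ℝ≥0) with hδdef
      have hδpos : 0 < δ := by positivity
      set m := ⌈t / δ⌉₊
      have hm1 : t ≤ m * δ := by
        rw [← div_le_iff₀ hδpos]; exact Nat.le_ceil _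
      have hm2 : m * δ < min u s := by
        have h3 : (m : ℝ≥0) < t / δ + 1 := Nat.ceil_lt_add_one (by positivity)
        calc m * δ < (t / δ + 1) * δ := by gcongr
          _ = t + δ := by field_simp
          _ < min u s := by rw [add_comm]; exact lt_tsub_iff_right.1 hn
      have hmA : Z (m * δ) ∈ A := hu' ⟨hm1, hm2.trans_le (min_le_left _ _)⟩
      have hN : entryIndex A (fun j => Z (j * δ)) (n + 1) ≤ m := by
        by_contra hc
        exact notMem_of_lt_entryIndex (not_le.1 hc) hmA
      calc _ ≤ (m : ℝ≥0) * δ := by gcongr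
        _ < s := hm2.trans_le (min_le_right _ _)

end Grid

/-! ### Dynkin's formula and mean entry times for planar Brownian motion. -/

namespace IsPlanarBrownian

variable {Ω : Type u} [MeasurableSpace Ω] {P : Measure Ω} [IsProbabilityMeasure P]
  {W : ℝ≥0 → Ω → EuclideanSpace ℝ (Fin 2)}

theorem map_grid_increment (hW : IsPlanarBrownian W P) (v : ℂ) (δ : ℝ≥0) (K : ℕ) :
    P.map (fun ω => ((fun j : Fin (K + 1) => planarPath W v ((j : ℕ) * δ) ω),
        planarPath W v ((K + 1 : ℕ) * δ) ω - planarPath W v (K * δ) ω))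
      = (P.map (fun ω (j : Fin (K + 1)) => planarPath W v ((j : ℕ) * δ) ω)).prod
        (complexGaussian δ) := by
  have h := hW.map_past_increment v (fun j : Fin (K + 1) => (j : ℕ) * δ) (K * δ) δ fun j => by
    have : (j : ℕ) ≤ K := Nat.lt_succ_iff.1 j.2
    gcongr
  rw [← h]
  congr 2
  push_cast
  rw [add_mul, one_mul]

theorem aemeasurable_truncEntryTime (hW : IsPlanarBrownian W P) (v : ℂ) {A : Set ℂ}
    (hA : IsOpen A) (T : ℝ≥0) :
    AEMeasurable (fun ω => truncEntryTime (fun t => planarPath W v t ω) A T) P := by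
  have hm : ∀ n : ℕ, AEMeasurable (fun ω => (entryIndex A
      (fun j => planarPath W v (j * (T / (n + 1 : ℕ))) ω) (n + 1) : ℝ)) P := fun n =>
    -- Only the integrability of the entry index is wanted, so the discrete formula is applied to
    -- the zero function.
    (abs_integral_entryIndex_sub_le (S := fun j => planarPath W v (j * (T / (n + 1 : ℕ))))
      (fun j => hW.aemeasurable_planarPath v _) (hW.map_grid_increment v _) hA.measurableSet
      (f := fun _ => 0) measurable_const (M := 0) (by simp) (δ := 0) (η := 0) le_rfl
      (by simp) (n + 1)).2.1.aemeasurable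
  refine aemeasurable_of_tendsto_metrizable_ae atTop
    (f := fun (n : ℕ) ω => (entryIndex A
      (fun j => planarPath W v (j * (T / (n + 1 : ℕ))) ω) (n + 1) : ℝ≥0) * (T / (n + 1 : ℕ)))
    (fun n => ?_) ?_
  · refine AEMeasurable.mul_const ?_ _
    have := (hm n).real_toNNReal
    simpa using this
  · filter_upwards [hW.ae_continuous_planarPath v] with ω hω
    exact tendsto_entryIndex_mul hω.1 hA T

theorem aemeasurable_entryTime (hW : IsPlanarBrownian W P) (v : ℂ) {A : Set ℂ} (hA : IsOpen A) :
    AEMeasurable (fun ω => entryTime (fun t => planarPath W v t ω) A) P := by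
  have : (fun ω => entryTime (fun t => planarPath W v t ω) A)
      = fun ω => ⨆ n : ℕ, (truncEntryTime (fun t => planarPath W v t ω) A n : ℝ≥0∞) := by
    ext ω
    simp only [coe_truncEntryTime, iSup_min_natCast]
  rw [this]
  exact AEMeasurable.iSup fun n => (hW.aemeasurable_truncEntryTime v hA n).coe_nnreal_ennreal

/-- Dynkin's formula for a function whose circle averages outside the open set `A` are those of
a function with Laplacian `2`. -/
theorem integral_apply_truncEntryTime (hW : IsPlanarBrownian W P) {v : ℂ} {A : Set ℂ}
    (hA : IsOpen A) (hv : v ∉ A) {g : ℂ → ℝ} (hg : Measurable g) {M : ℝ} (hM : ∀ z, |g z| ≤ M)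
    (hcont : ∀ z ∉ A, ContinuousAt g z) {ρ₀ : ℝ} (hρ₀ : 0 < ρ₀)
    (hcirc : ∀ z ∉ A, ∀ ρ, 0 < ρ → ρ < ρ₀ → Real.circleAverage g z ρ = g z + ρ ^ 2 / 2)
    {T : ℝ≥0} (hT : 0 < T) :
    Integrable (fun ω => g (planarPath W v
      (truncEntryTime (fun t => planarPath W v t ω) A T) ω)) P ∧
    Integrable (fun ω => (truncEntryTime (fun t => planarPath W v t ω) A T : ℝ)) P ∧
    ∫ ω, g (planarPath W v (truncEntryTime (fun t => planarPath W v t ω) A T) ω) ∂P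
      = g v + ∫ ω, (truncEntryTime (fun t => planarPath W v t ω) A T : ℝ) ∂P := by
  obtain ⟨C, hC0, hC⟩ := exists_abs_integral_complexGaussian_sub_le M ρ₀ hρ₀
    ((abs_nonneg _).trans (hM 0))
  let δ : ℕ → ℝ≥0 := fun n => T / (n + 1 : ℕ)
  have hδ : ∀ n, δ n ≠ 0 := fun n => by simp only [δ]; positivity
  let N : ℕ → Ω → ℕ := fun n ω => entryIndex A (fun j => planarPath W v (j * δ n) ω) (n + 1)
  let σ : Ω → ℝ≥0 := fun ω => truncEntryTime (fun t => planarPath W v t ω) A T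
  have hstep := fun n : ℕ => abs_integral_entryIndex_sub_le
    (S := fun j => planarPath W v (j * δ n))
    (fun j => hW.aemeasurable_planarPath v _) (hW.map_grid_increment v _) hA.measurableSet
    hg hM (δ := δ n) (η := C * (δ n : ℝ) ^ 2) (by positivity)
    (fun z hz => hC g hg hM z (hcirc z hz) (δ n) (hδ n)) (n + 1)
  have hlim : ∀ᵐ ω ∂P, Tendsto (fun n => (N n ω : ℝ≥0) * δ n) atTop (𝓝 (σ ω)) := by
    filter_upwards [hW.ae_continuous_planarPath v] with ω hω
    exact tendsto_entryIndex_mul hω.1 hA T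
  have hglim : ∀ᵐ ω ∂P, Tendsto (fun n => g (planarPath W v (N n ω * δ n) ω)) atTop
      (𝓝 (g (planarPath W v (σ ω) ω))) := by
    filter_upwards [hW.ae_continuous_planarPath v, hlim] with ω hω hl
    -- The limiting position is still outside the open set `A`, where `g` is continuous.
    refine (hcont _ ?_).tendsto.comp ((hω.1.tendsto _).comp hl)
    exact apply_truncEntryTime_notMem hω.1 hA (by rw [hω.2]; exact hv)
  have hgm : ∀ n, AEStronglyMeasurable (fun ω => g (planarPath W v (N n ω * δ n) ω)) P :=
    fun n => (hstep n).1.aestronglyMeasurable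
  have hgσ : AEStronglyMeasurable (fun ω => g (planarPath W v (σ ω) ω)) P :=
    aestronglyMeasurable_of_tendsto_ae atTop hgm hglim
  have hσm : AEMeasurable σ P := hW.aemeasurable_truncEntryTime v hA T
  refine ⟨Integrable.of_bound hgσ M (ae_of_all _ fun ω => hM _),
    Integrable.of_bound hσm.coe_nnreal_real.aestronglyMeasurable T (ae_of_all _ fun ω => ?_), ?_⟩
  · simpa using truncEntryTime_le
  have l1 : Tendsto (fun n => ∫ ω, g (planarPath W v (N n ω * δ n) ω) ∂P) atTop
      (𝓝 (∫ ω, g (planarPath W v (σ ω) ω) ∂P)) :=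
    tendsto_integral_of_dominated_convergence (fun _ => M) hgm (integrable_const _)
      (fun n => ae_of_all _ fun ω => hM _) hglim
  have l2 : Tendsto (fun n => ∫ ω, (N n ω : ℝ) * δ n ∂P) atTop (𝓝 (∫ ω, (σ ω : ℝ) ∂P)) := by
    refine tendsto_integral_of_dominated_convergence (fun _ => (T : ℝ))
      (fun n => ((hstep n).2.1.mul_const _).aestronglyMeasurable) (integrable_const _)
      (fun n => ae_of_all _ fun ω => ?_) ?_
    · have h1 : (N n ω : ℝ) ≤ (n + 1 : ℕ) := by exact_mod_cast entryIndex_le _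
      rw [Real.norm_eq_abs, abs_of_nonneg (by positivity)]
      calc (N n ω : ℝ) * δ n ≤ (n + 1 : ℕ) * δ n := by gcongr
        _ = T := by simp only [δ]; push_cast; field_simp
    · filter_upwards [hlim] with ω hω
      have := (NNReal.continuous_coe.tendsto _).comp hω
      simpa [Function.comp_def] using this
  have h0 : ∀ n, ∫ ω, g (planarPath W v ((0 : ℕ) * δ n) ω) ∂P = g v := fun n => by
    have : ∀ᵐ ω ∂P, g (planarPath W v ((0 : ℕ) * δ n) ω) = g v := by
      filter_upwards [hW.ae_continuous_planarPath v] with ω hω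
      simp [hω.2]
    rw [integral_congr_ae this]; simp
  -- There are `n + 1` steps, each with error `C (T / (n + 1))²`.
  have l3 : Tendsto (fun n : ℕ => ((n + 1 : ℕ) : ℝ) * (C * (δ n : ℝ) ^ 2)) atTop (𝓝 0) := by
    have : ∀ n : ℕ, ((n + 1 : ℕ) : ℝ) * (C * (δ n : ℝ) ^ 2) = C * T ^ 2 / ((n + 1 : ℕ) : ℝ) := by
      intro n; simp only [δ]; push_cast; field_simp
    simp only [this]
    exact (tendsto_const_div_atTop_nhds_zero_nat _).comp (tendsto_add_atTop_nat 1)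
  have l4 : Tendsto (fun n => (∫ ω, g (planarPath W v (N n ω * δ n) ω) ∂P) - g v
      - ∫ ω, (N n ω : ℝ) * δ n ∂P) atTop (𝓝 0) := by
    refine squeeze_zero_norm (fun n => ?_) l3
    have := (hstep n).2.2
    rw [h0] at this
    rw [integral_mul_const, mul_comm _ (δ n : ℝ)]
    exact this
  have := tendsto_nhds_unique l4 ((l1.sub tendsto_const_nhds).sub l2)
  linarith

/-- Two-sided bounds for the mean entry time into an open set. -/
theorem lintegral_entryTime_bounds (hW : IsPlanarBrownian W P) {v : ℂ} {A : Set ℂ}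
    (hA : IsOpen A) (hv : v ∉ A) {g : ℂ → ℝ} (hg : Measurable g) {M : ℝ} (hM : ∀ z, |g z| ≤ M)
    (hcont : ∀ z ∉ A, ContinuousAt g z) {ρ₀ : ℝ} (hρ₀ : 0 < ρ₀)
    (hcirc : ∀ z ∉ A, ∀ ρ, 0 < ρ → ρ < ρ₀ → Real.circleAverage g z ρ = g z + ρ ^ 2 / 2)
    {a b : ℝ} (hb : ∀ z ∉ A, g z ≤ b) (ha : ∀ z ∉ A, z ∈ closure A → a ≤ g z) :
    ∫⁻ ω, entryTime (fun t => planarPath W v t ω) A ∂P ≤ ENNReal.ofReal (b - g v) ∧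
    ENNReal.ofReal (a - g v) ≤ ∫⁻ ω, entryTime (fun t => planarPath W v t ω) A ∂P := by
  let Z : Ω → ℝ≥0 → ℂ := fun ω t => planarPath W v t ω
  have dyn := fun (n : ℕ) => hW.integral_apply_truncEntryTime hA hv hg hM hcont hρ₀ hcirc
    (T := ((n + 1 : ℕ) : ℝ≥0)) (by positivity)
  let I : ℕ → ℝ := fun n => ∫ ω, (truncEntryTime (Z ω) A ((n + 1 : ℕ) : ℝ≥0) : ℝ) ∂P
  have hI : ∀ n, ∫⁻ ω, min (entryTime (Z ω) A) (((n + 1 : ℕ) : ℝ≥0) : ℝ≥0∞) ∂P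
      = ENNReal.ofReal (I n) := fun n => by
    rw [ofReal_integral_eq_lintegral_ofReal (dyn n).2.1 (ae_of_all _ fun ω => NNReal.coe_nonneg _)]
    simp only [ENNReal.ofReal_coe_nnreal, coe_truncEntryTime]
    rfl
  have hnot : ∀ n : ℕ, ∀ᵐ ω ∂P, Z ω (truncEntryTime (Z ω) A ((n + 1 : ℕ) : ℝ≥0)) ∉ A := fun n => by
    filter_upwards [hW.ae_continuous_planarPath v] with ω hω
    exact apply_truncEntryTime_notMem hω.1 hA (by simp only [Z]; rw [hω.2]; exact hv)
  have hIb : ∀ n, I n ≤ b - g v := fun n => by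
    have h1 : ∫ ω, g (Z ω (truncEntryTime (Z ω) A ((n + 1 : ℕ) : ℝ≥0))) ∂P ≤ ∫ _, b ∂P :=
      integral_mono_ae (dyn n).1 (integrable_const _) (by
        filter_upwards [hnot n] with ω hω using hb _ hω)
    rw [(dyn n).2.2] at h1
    simp only [integral_const, probReal_univ, one_smul] at h1
    simp only [I]
    linarith
  constructor
  · have hmon : ∀ ω, entryTime (Z ω) A
        = ⨆ n : ℕ, min (entryTime (Z ω) A) (((n + 1 : ℕ) : ℝ≥0) : ℝ≥0∞) := fun ω => by
      refine le_antisymm ?_ (iSup_le fun n => min_le_left _ _)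
      conv_lhs => rw [← iSup_min_natCast (entryTime (Z ω) A)]
      refine iSup_mono fun n => min_le_min le_rfl ?_
      exact_mod_cast Nat.le_succ n
    calc ∫⁻ ω, entryTime (Z ω) A ∂P
        = ∫⁻ ω, ⨆ n : ℕ, min (entryTime (Z ω) A) (((n + 1 : ℕ) : ℝ≥0) : ℝ≥0∞) ∂P :=
          lintegral_congr hmon
      _ = ⨆ n : ℕ, ∫⁻ ω, min (entryTime (Z ω) A) (((n + 1 : ℕ) : ℝ≥0) : ℝ≥0∞) ∂P := by
          refine lintegral_iSup' (fun n => (hW.aemeasurable_entryTime v hA).min aemeasurable_const)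
            (ae_of_all _ fun ω m n hmn => min_le_min le_rfl ?_)
          exact_mod_cast Nat.succ_le_succ hmn
      _ ≤ _ := iSup_le fun n => by rw [hI]; exact ENNReal.ofReal_le_ofReal (hIb n)
  -- The lower bound `a` holds only at actual entries. If entry has not occurred before `T = n + 1`,
  -- the penalty `c σ / T` equals `c`, and `a - c ≤ -M ≤ g`. The mean penalty is at most `c (b - g
  -- v) / T`, which tends to `0`.
  · set c := |a| + M
    have hc0 : 0 ≤ c := add_nonneg (abs_nonneg _) ((abs_nonneg _).trans (hM 0))
    have hlow : ∀ n : ℕ, a - g v - c * (b - g v) / ((n + 1 : ℕ) : ℝ) ≤ I n := fun n => by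
      have hn : (0 : ℝ) < ((n + 1 : ℕ) : ℝ) := by positivity
      have h1 : ∫ ω, (a - c / ((n + 1 : ℕ) : ℝ)
            * (truncEntryTime (Z ω) A ((n + 1 : ℕ) : ℝ≥0) : ℝ)) ∂P
          ≤ ∫ ω, g (Z ω (truncEntryTime (Z ω) A ((n + 1 : ℕ) : ℝ≥0))) ∂P := by
        refine integral_mono_ae ((integrable_const _).sub ((dyn n).2.1.const_mul _)) (dyn n).1 ?_
        filter_upwards [hnot n, hW.ae_continuous_planarPath v] with ω hω hω'
        rcases le_or_gt (((n + 1 : ℕ) : ℝ≥0) : ℝ≥0∞) (entryTime (Z ω) A) with h | h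
        · have e : c / ((n + 1 : ℕ) : ℝ)
              * (truncEntryTime (Z ω) A ((n + 1 : ℕ) : ℝ≥0) : ℝ) = c := by
            rw [truncEntryTime_eq_of_le h, NNReal.coe_natCast]
            field_simp
          simp only [e]
          have h2 := neg_le_of_abs_le (hM (Z ω (truncEntryTime (Z ω) A ((n + 1 : ℕ) : ℝ≥0))))
          have h3 := le_abs_self a
          simp only [c]
          linarith
        · have h2 := ha _ hω (apply_truncEntryTime_mem_closure hω'.1 h)
          have h3 : 0 ≤ c / ((n + 1 : ℕ) : ℝ)
            * (truncEntryTime (Z ω) A ((n + 1 : ℕ) : ℝ≥0) : ℝ) := by positivity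
          linarith
      have h2 : ∫ ω, (a - c / ((n + 1 : ℕ) : ℝ)
            * (truncEntryTime (Z ω) A ((n + 1 : ℕ) : ℝ≥0) : ℝ)) ∂P
          = a - c / ((n + 1 : ℕ) : ℝ) * I n := by
        rw [integral_sub (integrable_const _) ((dyn n).2.1.const_mul _), integral_const_mul,
          integral_const, probReal_univ, one_smul]
      rw [h2, (dyn n).2.2] at h1
      have h3 : c / ((n + 1 : ℕ) : ℝ) * I n ≤ c / ((n + 1 : ℕ) : ℝ) * (b - g v) :=
        mul_le_mul_of_nonneg_left (hIb n) (by positivity)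
      rw [mul_div_right_comm]
      change _ ≤ g v + I n at h1
      linarith
    have hlim : Tendsto (fun n : ℕ => ENNReal.ofReal
        (a - g v - c * (b - g v) / ((n + 1 : ℕ) : ℝ))) atTop (𝓝 (ENNReal.ofReal (a - g v - 0))) :=
      (ENNReal.continuous_ofReal.tendsto _).comp (tendsto_const_nhds.sub
        ((tendsto_const_div_atTop_nhds_zero_nat _).comp (tendsto_add_atTop_nat 1)))
    rw [sub_zero] at hlim
    refine le_of_tendsto' hlim fun n => ?_
    calc _ ≤ ENNReal.ofReal (I n) := ENNReal.ofReal_le_ofReal (hlow n)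
      _ = _ := (hI n).symm
      _ ≤ _ := lintegral_mono fun ω => min_le_left _ _

end IsPlanarBrownian

/-! ### Circle averages of coordinate functions. -/

section CircleAverages

theorem circleAverage_im (c : ℂ) (ρ : ℝ) : Real.circleAverage Complex.im c ρ = c.im := by
  have : ∀ θ : ℝ, (circleMap c ρ θ).im = c.im + ρ * Real.sin θ := fun θ => by
    simp [circleMap, Complex.exp_mul_I, ← Complex.ofReal_cos, ← Complex.ofReal_sin]
  rw [Real.circleAverage_def]
  simp only [this]
  rw [intervalIntegral.integral_add (by simp) (Continuous.intervalIntegrable (by fun_prop) _ _),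
    intervalIntegral.integral_const_mul, integral_sin]
  simp
  field_simp

theorem circleAverage_im_sq (c : ℂ) (ρ : ℝ) :
    Real.circleAverage (fun z => z.im ^ 2) c ρ = c.im ^ 2 + ρ ^ 2 / 2 := by
  have : ∀ θ : ℝ, (circleMap c ρ θ).im ^ 2
      = c.im ^ 2 + (2 * c.im * ρ) * Real.sin θ + ρ ^ 2 * Real.sin θ ^ 2 := fun θ => by
    have : (circleMap c ρ θ).im = c.im + ρ * Real.sin θ := by
      simp [circleMap, Complex.exp_mul_I, ← Complex.ofReal_cos, ← Complex.ofReal_sin]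
    rw [this]; ring
  rw [Real.circleAverage_def]
  simp only [this]
  rw [intervalIntegral.integral_add (Continuous.intervalIntegrable (by fun_prop) _ _)
      (Continuous.intervalIntegrable (by fun_prop) _ _),
    intervalIntegral.integral_add (by simp) (Continuous.intervalIntegrable (by fun_prop) _ _),
    intervalIntegral.integral_const_mul, intervalIntegral.integral_const_mul, integral_sin,
    integral_sin_sq]
  simp
  field_simp

theorem circleAverage_re_sq (c : ℂ) (ρ : ℝ) :
    Real.circleAverage (fun z => z.re ^ 2) c ρ = c.re ^ 2 + ρ ^ 2 / 2 := by
  have : ∀ θ : ℝ, (circleMap c ρ θ).re ^ 2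
      = c.re ^ 2 + (2 * c.re * ρ) * Real.cos θ + ρ ^ 2 * Real.cos θ ^ 2 := fun θ => by
    have : (circleMap c ρ θ).re = c.re + ρ * Real.cos θ := by
      simp [circleMap, Complex.exp_mul_I, ← Complex.ofReal_cos, ← Complex.ofReal_sin]
    rw [this]; ring
  rw [Real.circleAverage_def]
  simp only [this]
  rw [intervalIntegral.integral_add (Continuous.intervalIntegrable (by fun_prop) _ _)
      (Continuous.intervalIntegrable (by fun_prop) _ _),
    intervalIntegral.integral_add (by simp) (Continuous.intervalIntegrable (by fun_prop) _ _),
    intervalIntegral.integral_const_mul, intervalIntegral.integral_const_mul, integral_cos,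
    integral_cos_sq]
  simp
  field_simp

end CircleAverages

/-! ### Theta function and Green function of the square lattice. -/

namespace SquareTheta

/-- The nome `exp (-2π)` of the square lattice. -/
def nome : ℂ := Complex.exp (-(2 * Real.pi))

theorem norm_nome : ‖nome‖ = Real.exp (-(2 * Real.pi)) := by
  simp [nome, Complex.norm_exp]

theorem norm_nome_lt_one : ‖nome‖ < 1 := by
  rw [norm_nome, Real.exp_lt_one_iff]
  linarith [Real.pi_pos]

/-- The Euler product `∏ₙ (1 - qⁿ w)`. -/
def eulerProd (w : ℂ) : ℂ := ∏' n : ℕ, (1 + -(nome ^ n * w))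

theorem summable_norm_nome_pow_mul (w : ℂ) : Summable fun n : ℕ => ‖-(nome ^ n * w)‖ := by
  simp only [norm_neg, norm_mul, norm_pow]
  exact (summable_geometric_of_lt_one (norm_nonneg _) norm_nome_lt_one).mul_right _

theorem differentiable_eulerProd : Differentiable ℂ eulerProd := by
  have h : HasProdLocallyUniformlyOn (fun (n : ℕ) (w : ℂ) => 1 + -(nome ^ n * w)) eulerProd
      Set.univ := by
    refine hasProdLocallyUniformlyOn_of_forall_compact isOpen_univ fun K _ hK => ?_
    obtain ⟨R, hR⟩ := hK.isBounded.exists_norm_le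
    refine ((summable_geometric_of_lt_one (norm_nonneg _) norm_nome_lt_one).mul_right
      R).hasProdUniformlyOn_nat_one_add hK (.of_forall fun n x hx => ?_) fun n => by fun_prop
    rw [norm_neg, norm_mul, norm_pow]
    exact mul_le_mul_of_nonneg_left (hR x hx) (by positivity)
  exact differentiableOn_univ.1 (h.differentiableOn (.of_forall fun _ => by
    simpa [Finset.prod_fn] using DifferentiableOn.finsetProd fun _ _ => by fun_prop) isOpen_univ)

theorem eulerProd_eq (w : ℂ) : eulerProd w = (1 - w) * eulerProd (nome * w) := by
  have e : (fun n : ℕ => 1 + -(nome ^ (n + 1) * w)) = fun n => 1 + -(nome ^ n * (nome * w)) := by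
    ext n; rw [pow_succ, mul_assoc]
  have h : Multipliable fun n : ℕ => 1 + -(nome ^ (n + 1) * w) :=
    e ▸ multipliable_one_add_of_summable (summable_norm_nome_pow_mul (nome * w))
  have h1 := tprod_eq_zero_mul' (f := fun n : ℕ => 1 + -(nome ^ n * w)) h
  have h2 : ∏' n : ℕ, (1 + -(nome ^ (n + 1) * w)) = eulerProd (nome * w) :=
    congrArg (fun f : ℕ → ℂ => ∏' n, f n) e
  rw [h2, pow_zero, one_mul, ← sub_eq_add_neg] at h1
  exact h1

theorem eulerProd_ne_zero {w : ℂ} (h : ∀ n : ℕ, nome ^ n * w ≠ 1) : eulerProd w ≠ 0 :=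
  tprod_one_add_ne_zero_of_summable (fun n hn => h n (by linear_combination -hn))
    (summable_norm_nome_pow_mul w)

/-- The exponential `exp (2πiz)`. -/
def cexpTwoPi (z : ℂ) : ℂ := Complex.exp (2 * Real.pi * Complex.I * z)

theorem cexpTwoPi_add (z w : ℂ) : cexpTwoPi (z + w) = cexpTwoPi z * cexpTwoPi w := by
  rw [cexpTwoPi, mul_add, Complex.exp_add]; rfl

theorem cexpTwoPi_zero : cexpTwoPi 0 = 1 := by simp [cexpTwoPi]

theorem cexpTwoPi_neg_mul (z : ℂ) : cexpTwoPi (-z) * cexpTwoPi z = 1 := by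
  rw [← cexpTwoPi_add, neg_add_cancel, cexpTwoPi_zero]

theorem cexpTwoPi_intCast (m : ℤ) : cexpTwoPi m = 1 := by
  rw [cexpTwoPi, Complex.exp_eq_one_iff]; exact ⟨m, by ring⟩

theorem cexpTwoPi_mul_I : cexpTwoPi Complex.I = nome := by
  rw [cexpTwoPi, nome]; congr 1; linear_combination 2 * (Real.pi : ℂ) * Complex.I_mul_I

theorem norm_cexpTwoPi (z : ℂ) : ‖cexpTwoPi z‖ = Real.exp (-(2 * Real.pi * z.im)) := by
  rw [cexpTwoPi, Complex.norm_exp]; congr 1; simp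

theorem differentiable_cexpTwoPi : Differentiable ℂ cexpTwoPi := by
  unfold cexpTwoPi; fun_prop

theorem nome_pow_eq (n : ℕ) : nome ^ n = cexpTwoPi (n * Complex.I) := by
  rw [← cexpTwoPi_mul_I, cexpTwoPi, cexpTwoPi, ← Complex.exp_nat_mul]; congr 1; ring

/-- `z` is not a Gaussian integer. -/
def OffLattice (z : ℂ) : Prop := ∀ m n : ℤ, z ≠ m + n * Complex.I

theorem OffLattice.cexpTwoPi_ne_one {z : ℂ} (h : OffLattice z) : cexpTwoPi z ≠ 1 := by
  intro h1
  rw [cexpTwoPi, Complex.exp_eq_one_iff] at h1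
  obtain ⟨m, hm⟩ := h1
  have hne : (2 * Real.pi * Complex.I : ℂ) ≠ 0 := Complex.two_pi_I_ne_zero
  refine h m 0 ?_
  rw [mul_comm (m : ℂ)] at hm
  simpa using mul_left_cancel₀ hne hm

theorem OffLattice.add {z : ℂ} (h : OffLattice z) (m n : ℤ) :
    OffLattice (z + (m + n * Complex.I)) := fun a b hab =>
  h (a - m) (b - n) (by push_cast; linear_combination hab)

theorem OffLattice.neg {z : ℂ} (h : OffLattice z) : OffLattice (-z) := fun a b hab =>
  h (-a) (-b) (by push_cast; linear_combination -hab)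

/-- A theta function of the square lattice, with zeros at the Gaussian integers. -/
def theta (z : ℂ) : ℂ := eulerProd (cexpTwoPi z) * eulerProd (nome * cexpTwoPi (-z))

theorem differentiable_theta : Differentiable ℂ theta :=
  (differentiable_eulerProd.comp differentiable_cexpTwoPi).mul
    (differentiable_eulerProd.comp ((differentiable_cexpTwoPi.comp differentiable_neg).const_mul _))

/-- A vanishing factor would mean `cexpTwoPi (±z + n * I) = 1` for some integer `n`, placing `z` on
the lattice. -/
theorem theta_ne_zero {z : ℂ} (h : OffLattice z) : theta z ≠ 0 := by
  refine mul_ne_zero (eulerProd_ne_zero fun n => ?_) (eulerProd_ne_zero fun n => ?_)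
  · rw [nome_pow_eq, ← cexpTwoPi_add]
    have := (h.add 0 n).cexpTwoPi_ne_one
    rw [add_comm z] at this
    simpa using this
  · rw [← mul_assoc, ← pow_succ, nome_pow_eq, ← cexpTwoPi_add]
    have := (h.neg.add 0 (n + 1)).cexpTwoPi_ne_one
    rw [add_comm (-z)] at this
    simpa using this

theorem theta_add_intCast (z : ℂ) (m : ℤ) : theta (z + m) = theta z := by
  have : cexpTwoPi (-(z + m)) = cexpTwoPi (-z) := by
    rw [show -(z + m) = -z + ((-m : ℤ) : ℂ) by push_cast; ring, cexpTwoPi_add, cexpTwoPi_intCast,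
      mul_one]
  rw [theta, theta, cexpTwoPi_add, cexpTwoPi_intCast, this, mul_one]

/-- The shift multiplies `cexpTwoPi z` by the nome: one product loses its first factor, the other
gains one. -/
theorem theta_add_I (z : ℂ) : theta (z + Complex.I) = -cexpTwoPi (-z) * theta z := by
  have h1 : nome * cexpTwoPi (-(z + Complex.I)) = cexpTwoPi (-z) := by
    rw [← cexpTwoPi_mul_I, ← cexpTwoPi_add]; congr 1; ring
  rw [theta, theta, h1, cexpTwoPi_add, cexpTwoPi_mul_I, eulerProd_eq (cexpTwoPi (-z)),
    eulerProd_eq (cexpTwoPi z), mul_comm (cexpTwoPi z) nome]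
  linear_combination -eulerProd (nome * cexpTwoPi z) * eulerProd (nome * cexpTwoPi (-z))
    * cexpTwoPi_neg_mul z

/-- The Green function of the square torus, up to sign: it has Laplacian `-2` off the Gaussian
integers and a singularity `π⁻¹ log ‖z‖` at each of them. -/
def green (z : ℂ) : ℝ := Real.pi⁻¹ * Real.log ‖theta z‖ - z.im ^ 2 + z.im

/-- The multiplier of `theta` has norm `exp (2π Im z)`, adding `2 Im z`; the quadratic `-y² + y`
changes by exactly `-2y`. -/
theorem green_add_I {z : ℂ} (h : OffLattice z) : green (z + Complex.I) = green z := by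
  have h1 : ‖theta z‖ ≠ 0 := norm_ne_zero_iff.2 (theta_ne_zero h)
  rw [green, green, theta_add_I, norm_mul, norm_neg, norm_cexpTwoPi,
    Real.log_mul (Real.exp_ne_zero _) h1, Real.log_exp]
  have := Real.pi_ne_zero
  simp
  field_simp
  ring

theorem green_add {z : ℂ} (h : OffLattice z) (m n : ℤ) :
    green (z + (m + n * Complex.I)) = green z := by
  have h1 : ∀ k : ℤ, green (z + m + k * Complex.I) = green (z + m) := by
    have step : ∀ k : ℤ, green (z + m + ((k + 1 : ℤ) : ℂ) * Complex.I)
        = green (z + m + k * Complex.I) := fun k => by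
      have := green_add_I (h.add m k)
      rw [← add_assoc] at this
      rw [← this]
      congr 1
      push_cast; ring
    intro k
    induction k using Int.induction_on with
    | zero => simp
    | succ k ih => rw [step, ih]
    | pred k ih => rw [← ih, ← step (-(k : ℤ) - 1)]; congr 3; push_cast; ring
  rw [← add_assoc, h1, green, green, theta_add_intCast]
  simp

/-- `log ‖theta‖` is harmonic where `theta` has no zeros and `Im` is harmonic everywhere, so only
`-Im²` shifts the average. -/
theorem circleAverage_green {z : ℂ} {ρ : ℝ} (hρ : 0 < ρ)
    (h : ∀ w ∈ Metric.closedBall z ρ, OffLattice w) :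
    Real.circleAverage green z ρ = green z - ρ ^ 2 / 2 := by
  have h1 : Real.circleAverage (Real.log ‖theta ·‖) z ρ = Real.log ‖theta z‖ :=
    AnalyticOnNhd.circleAverage_log_norm_of_ne_zero
      (fun w _ => differentiable_theta.analyticAt w)
      (fun w hw => theta_ne_zero (h w (by rwa [abs_of_pos hρ] at hw)))
  have i1 : CircleIntegrable (Real.log ‖theta ·‖) z ρ := by
    refine ContinuousOn.circleIntegrable' fun w hw => ?_
    have hw' : theta w ≠ 0 := theta_ne_zero (h w (by
      rw [abs_of_pos hρ] at hw; exact Metric.sphere_subset_closedBall hw))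
    exact (differentiable_theta.continuous.continuousAt.norm.log
      (norm_ne_zero_iff.2 hw')).continuousWithinAt
  have i2 : CircleIntegrable (fun w : ℂ => w.im ^ 2) z ρ :=
    (Continuous.continuousOn (by fun_prop)).circleIntegrable'
  have i3 : CircleIntegrable Complex.im z ρ :=
    (Continuous.continuousOn (by fun_prop)).circleIntegrable'
  have e : green = (Real.pi⁻¹ • (Real.log ‖theta ·‖) - fun w : ℂ => w.im ^ 2) + Complex.im := rfl
  rw [e, Real.circleAverage_add ((i1.const_smul).sub i2) i3,
    Real.circleAverage_sub i1.const_smul i2, Real.circleAverage_smul, h1, circleAverage_im_sq,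
    circleAverage_im]
  simp
  ring

theorem theta_zero : theta 0 = 0 := by
  rw [theta, cexpTwoPi_zero, eulerProd_eq]; simp

/-- The zero comes from the single factor `1 - cexpTwoPi z`, which is simple at `0`; the cofactor
there is `eulerProd nome ^ 2`. -/
theorem deriv_theta_zero_ne_zero : deriv theta 0 ≠ 0 := by
  set R : ℂ → ℂ := fun z => eulerProd (nome * cexpTwoPi z) * eulerProd (nome * cexpTwoPi (-z))
  have hR : Differentiable ℂ R :=
    (differentiable_eulerProd.comp (differentiable_cexpTwoPi.const_mul _)).mul
    (differentiable_eulerProd.comp ((differentiable_cexpTwoPi.comp differentiable_neg).const_mul _))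
  have e : theta = fun z => (1 - cexpTwoPi z) * R z := by
    ext z; rw [theta, eulerProd_eq (cexpTwoPi z)]; simp only [R]; ring
  have h1 : HasDerivAt cexpTwoPi (2 * Real.pi * Complex.I) 0 := by
    have := (((hasDerivAt_id (0 : ℂ)).const_mul (2 * Real.pi * Complex.I))).cexp
    rw [id_eq, mul_zero, Complex.exp_zero, one_mul, mul_one] at this
    exact this
  have h2 := ((h1.const_sub 1).mul (hR 0).hasDerivAt)
  have h3 : deriv theta 0 = -(2 * Real.pi * Complex.I) * R 0 := by
    rw [e]
    refine h2.deriv.trans ?_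
    simp [cexpTwoPi_zero]
  have hE : eulerProd nome ≠ 0 := eulerProd_ne_zero fun n hn => by
    have := congrArg norm hn
    rw [← pow_succ, norm_pow, norm_one] at this
    exact absurd this (pow_lt_one₀ (norm_nonneg _) norm_nome_lt_one (by omega)).ne
  rw [h3]
  refine mul_ne_zero (neg_ne_zero.2 Complex.two_pi_I_ne_zero) ?_
  simpa [R, cexpTwoPi_zero] using hE

/-- The square of side one around the origin. -/
def unitSquare : Set ℂ := {z | |z.re| ≤ 1 / 2 ∧ |z.im| ≤ 1 / 2}

theorem isCompact_unitSquare : IsCompact unitSquare := by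
  refine Metric.isCompact_of_isClosed_isBounded ?_ ?_
  · exact (isClosed_le Complex.continuous_re.abs continuous_const).inter
      (isClosed_le Complex.continuous_im.abs continuous_const)
  · refine (Metric.isBounded_iff_subset_closedBall (0 : ℂ)).2 ⟨1, fun z hz => ?_⟩
    rw [mem_closedBall_zero_iff]
    have := Complex.norm_le_abs_re_add_abs_im z
    linarith [hz.1, hz.2]

theorem offLattice_of_mem_unitSquare {z : ℂ} (hz : z ∈ unitSquare) (h0 : z ≠ 0) :
    OffLattice z := by
  rintro m n rfl
  have h1 : |(m : ℝ)| ≤ 1 / 2 := by simpa using hz.1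
  have h2 : |(n : ℝ)| ≤ 1 / 2 := by simpa using hz.2
  have aux : ∀ k : ℤ, |(k : ℝ)| ≤ 1 / 2 → k = 0 := fun k hk => by
    have : |(k : ℝ)| < 1 := by linarith
    exact Int.abs_lt_one_iff.1 (by exact_mod_cast this)
  exact h0 (by simp [aux m h1, aux n h2])

/-- The quotient `theta z / z` extends to an entire function (`dslope`) without zeros on the compact
square, so the logarithm of its modulus is bounded there. -/
theorem exists_abs_green_sub_log_le :
    ∃ C : ℝ, 0 ≤ C ∧ ∀ z ∈ unitSquare, z ≠ 0 → |green z - Real.pi⁻¹ * Real.log ‖z‖| ≤ C := by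
  have hG : Differentiable ℂ (dslope theta 0) := by
    have := (Complex.differentiableOn_dslope (f := theta) (c := 0) (s := Set.univ)
      univ_mem).2 differentiable_theta.differentiableOn
    exact differentiableOn_univ.1 this
  have hne : ∀ z ∈ unitSquare, dslope theta 0 z ≠ 0 := fun z hz => by
    by_cases h0 : z = 0
    · rw [h0, dslope_same]; exact deriv_theta_zero_ne_zero
    · rw [dslope_of_ne _ h0, slope_def_field, theta_zero, sub_zero, sub_zero]
      exact div_ne_zero (theta_ne_zero (offLattice_of_mem_unitSquare hz h0)) h0
  obtain ⟨C, hC⟩ := isCompact_unitSquare.exists_bound_of_continuousOn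
    (f := fun z => Real.pi⁻¹ * Real.log ‖dslope theta 0 z‖ - z.im ^ 2 + z.im) (by
      have h1 : ContinuousOn (fun z => Real.log ‖dslope theta 0 z‖) unitSquare :=
        hG.continuous.norm.continuousOn.log fun z hz => norm_ne_zero_iff.2 (hne z hz)
      fun_prop)
  refine ⟨C, (norm_nonneg _).trans (hC 0 (by simp [unitSquare])), fun z hz h0 => ?_⟩
  have e : green z - Real.pi⁻¹ * Real.log ‖z‖
      = Real.pi⁻¹ * Real.log ‖dslope theta 0 z‖ - z.im ^ 2 + z.im := by
    rw [dslope_of_ne _ h0, slope_def_field, theta_zero, sub_zero, sub_zero, norm_div,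
      Real.log_div (norm_ne_zero_iff.2 (theta_ne_zero (offLattice_of_mem_unitSquare hz h0)))
      (norm_ne_zero_iff.2 h0), green]
    ring
  rw [e]
  exact hC z hz

theorem continuousAt_green {z : ℂ} (h : OffLattice z) : ContinuousAt green z := by
  have h1 := differentiable_theta.continuous.continuousAt (x := z).norm.log
      (norm_ne_zero_iff.2 (theta_ne_zero h))
  unfold green
  fun_prop

theorem measurable_green : Measurable green := by
  have := differentiable_theta.continuous.measurable
  unfold green
  fun_prop

end SquareTheta

/-! ### The torus distance as distance to the lattice. -/

section TorusNorm

/-- The covering map of the torus by the complex plane. -/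
def torusCover (z : ℂ) : Torus := Torus.proj (WithLp.toLp 2 ![z.re, z.im])

theorem torusCover_add (z w : ℂ) : torusCover (z + w) = torusCover z + torusCover w := by
  ext i
  fin_cases i <;> simp [torusCover, Torus.proj]

/-- The distance from `z` to the lattice of Gaussian integers. -/
def latticeDist (z : ℂ) : ℝ := ‖torusCover z‖

/-- The Gaussian integer obtained by rounding both coordinates. -/
def roundGaussian (z : ℂ) : ℂ := (round z.re : ℂ) + (round z.im : ℂ) * Complex.I

theorem sub_roundGaussian_mem_unitSquare (z : ℂ) : z - roundGaussian z ∈ SquareTheta.unitSquare := by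
  constructor
  · simpa [roundGaussian] using abs_sub_round z.re
  · simpa [roundGaussian] using abs_sub_round z.im

theorem latticeDist_eq_norm (z : ℂ) : latticeDist z = ‖z - roundGaussian z‖ := by
  rw [latticeDist, PiLp.norm_eq_of_L2, Fin.sum_univ_two, ← Real.sqrt_sq (norm_nonneg (z - _)),
    ← Complex.normSq_eq_norm_sq, Complex.normSq_apply]
  simp [torusCover, Torus.proj, UnitAddCircle.norm_eq, roundGaussian, pow_two]

theorem latticeDist_le_norm (z : ℂ) : latticeDist z ≤ ‖z‖ := by
  rw [latticeDist_eq_norm, ← sq_le_sq₀ (norm_nonneg _) (norm_nonneg _),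
    ← Complex.normSq_eq_norm_sq, ← Complex.normSq_eq_norm_sq, Complex.normSq_apply,
    Complex.normSq_apply]
  have h1 := sq_le_sq.2 (by simpa using round_le z.re 0 : |z.re - round z.re| ≤ |z.re|)
  have h2 := sq_le_sq.2 (by simpa using round_le z.im 0 : |z.im - round z.im| ≤ |z.im|)
  simp [roundGaussian]
  nlinarith

theorem latticeDist_eq_norm_of_mem_unitSquare {z : ℂ} (hz : z ∈ SquareTheta.unitSquare) :
    latticeDist z = ‖z‖ := by
  have aux : ∀ x : ℝ, |x| ≤ 1 / 2 → |x| ≤ |x - round x| := fun x hx => by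
    by_cases h : round x = 0
    · simp [h]
    -- This is the tie `x = 1 / 2`, rounded to `1`: the distance is still `1 / 2`.
    · have h1 : (1 : ℝ) ≤ |(round x : ℝ)| := by exact_mod_cast Int.one_le_abs h
      have h2 := abs_sub_abs_le_abs_sub (round x : ℝ) x
      rw [abs_sub_comm] at h2
      linarith
  refine le_antisymm (latticeDist_le_norm z) ?_
  rw [latticeDist_eq_norm, ← sq_le_sq₀ (norm_nonneg _) (norm_nonneg _),
    ← Complex.normSq_eq_norm_sq, ← Complex.normSq_eq_norm_sq, Complex.normSq_apply,
    Complex.normSq_apply]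
  have h1 := sq_le_sq.2 (aux _ hz.1)
  have h2 := sq_le_sq.2 (aux _ hz.2)
  simp [roundGaussian]
  nlinarith

theorem latticeDist_le_one (z : ℂ) : latticeDist z ≤ 1 := by
  rw [latticeDist_eq_norm]
  have h := sub_roundGaussian_mem_unitSquare z
  have := Complex.norm_le_abs_re_add_abs_im (z - roundGaussian z)
  linarith [h.1, h.2]

theorem latticeDist_le_add (z w : ℂ) : latticeDist w ≤ latticeDist z + ‖w - z‖ := by
  calc latticeDist w = ‖torusCover z + torusCover (w - z)‖ := by
        rw [← torusCover_add, add_sub_cancel]; rfl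
    _ ≤ latticeDist z + latticeDist (w - z) := norm_add_le _ _
    _ ≤ _ := by gcongr; exact latticeDist_le_norm _

theorem continuous_latticeDist : Continuous latticeDist := by
  refine (LipschitzWith.of_le_add fun z w => ?_).continuous
  rw [dist_eq_norm]
  exact latticeDist_le_add w z

theorem offLattice_of_latticeDist_pos {z : ℂ} (h : 0 < latticeDist z) :
    SquareTheta.OffLattice z := by
  rintro m n rfl
  rw [latticeDist_eq_norm] at h
  simp [roundGaussian] at h

theorem exists_mem_unitSquare_torusCover_eq (p : Torus) :
    ∃ v ∈ SquareTheta.unitSquare, torusCover v = p := by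
  obtain ⟨a, ha⟩ : ∃ a : ℝ, (a : UnitAddCircle) = p 0 := QuotientAddGroup.mk_surjective _
  obtain ⟨b, hb⟩ : ∃ b : ℝ, (b : UnitAddCircle) = p 1 := QuotientAddGroup.mk_surjective _
  obtain ⟨z, hz0, hz1⟩ : ∃ z : ℂ, z.re = a ∧ z.im = b := ⟨⟨a, b⟩, rfl, rfl⟩
  refine ⟨z - roundGaussian z, sub_roundGaussian_mem_unitSquare z, ?_⟩
  have h : ∀ k : ℤ, ((k : ℝ) : UnitAddCircle) = 0 := fun k =>
    (AddCircle.coe_eq_zero_iff (1 : ℝ)).2 ⟨k, by simp⟩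
  ext i
  fin_cases i
  · simpa [torusCover, Torus.proj, roundGaussian, h, hz0] using ha
  · simpa [torusCover, Torus.proj, roundGaussian, h, hz1] using hb

theorem exists_abs_green_sub_log_latticeDist_le :
    ∃ C : ℝ, 0 ≤ C ∧ ∀ z, 0 < latticeDist z →
      |SquareTheta.green z - Real.pi⁻¹ * Real.log (latticeDist z)| ≤ C := by
  obtain ⟨C, hC0, hC⟩ := SquareTheta.exists_abs_green_sub_log_le
  refine ⟨C, hC0, fun z hz => ?_⟩
  have h1 : SquareTheta.green (z - roundGaussian z) = SquareTheta.green z := by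
    rw [← SquareTheta.green_add (offLattice_of_latticeDist_pos hz) (-round z.re) (-round z.im)]
    congr 1
    simp only [roundGaussian]
    push_cast
    ring
  rw [latticeDist_eq_norm] at hz ⊢
  rw [← h1]
  exact hC _ (sub_roundGaussian_mem_unitSquare z) (norm_pos_iff.1 hz)

end TorusNorm

/-! ### Comparison of hitting times on the torus and in the plane. -/

section PathComparison

/-- If every larger sublevel set is visited before time `a`, the minimum of `D ∘ Z` over the compact
`[0, a]` is at most `r`. This gives measurability for closed balls. -/
theorem entryTime_le_eq_iSup {Z : ℝ≥0 → ℂ} (hZ : Continuous Z) {D : ℂ → ℝ} (hD : Continuous D)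
    (r : ℝ) : entryTime Z {z | D z ≤ r}
      = ⨆ n : ℕ, entryTime Z {z | D z < r + 1 / ((n : ℝ) + 1)} := by
  refine le_antisymm ?_ (iSup_le fun n => entryTime_anti fun z hz => ?_)
  swap
  · have hz' : D z ≤ r := hz
    exact hz'.trans_lt (lt_add_of_pos_right r Nat.one_div_pos_of_nat)
  refine le_of_forall_gt_imp_ge_of_dense fun a ha => ?_
  rcases eq_or_ne a ⊤ with rfl | hatop
  · exact le_top
  lift a to ℝ≥0 using hatop
  obtain ⟨s, hs, hmin⟩ := (isCompact_Icc (a := (0 : ℝ≥0)) (b := a)).exists_isMinOn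
    ⟨0, by simp⟩ (hD.comp hZ).continuousOn
  have h1 : D (Z s) ≤ r := by
    have h2 : ∀ n : ℕ, D (Z s) ≤ r + 1 / ((n : ℝ) + 1) := fun n => by
      obtain ⟨t, ht, hta⟩ := exists_mem_of_entryTime_lt ((le_iSup (fun n : ℕ =>
        entryTime Z {z | D z < r + 1 / ((n : ℝ) + 1)}) n).trans_lt ha)
      exact (hmin ⟨zero_le, (ENNReal.coe_lt_coe.1 hta).le⟩).trans (le_of_lt ht)
    have h3 : Tendsto (fun n : ℕ => r + 1 / ((n : ℝ) + 1)) atTop (𝓝 (r + 0)) :=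
      tendsto_const_nhds.add tendsto_one_div_add_atTop_nhds_zero_nat
    rw [add_zero] at h3
    exact ge_of_tendsto' h3 h2
  exact (entryTime_le (A := {z | D z ≤ r}) h1).trans (ENNReal.coe_le_coe.2 hs.2)

theorem entryTime_latticeDist_gt {Z : ℝ≥0 → ℂ} (hZ : Continuous Z) {s : ℝ} (hs : s < 1 / 2)
    (h0 : ‖Z 0‖ ≤ s) : entryTime Z {z | s < latticeDist z} = entryTime Z {z | s < ‖z‖} := by
  refine le_antisymm (le_iInf₂ fun t ht => ?_)
    (entryTime_anti fun z hz => lt_of_lt_of_le hz (latticeDist_le_norm z))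
  -- Before time `t` the norm takes a value in `(s, 1 / 2]`, a range where it agrees with
  -- `latticeDist`; so wrapping around the torus cannot delay the exit.
  have hm : min ‖Z t‖ (1 / 2) ∈ Set.Icc ‖Z 0‖ ‖Z t‖ :=
    ⟨le_min (h0.trans (le_of_lt ht)) (by linarith), min_le_left _ _⟩
  obtain ⟨u, hu, hu'⟩ := intermediate_value_Icc (zero_le (a := t)) (hZ.norm.continuousOn) hm
  have hle : ‖Z u‖ ≤ 1 / 2 := by simp only [hu']; exact min_le_right _ _
  have hsq : Z u ∈ SquareTheta.unitSquare :=
    ⟨(Complex.abs_re_le_norm _).trans hle, (Complex.abs_im_le_norm _).trans hle⟩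
  have : s < latticeDist (Z u) := by
    rw [latticeDist_eq_norm_of_mem_unitSquare hsq]
    simp only [hu']
    exact lt_min ht hs
  exact (entryTime_le (A := {z | s < latticeDist z}) this).trans (ENNReal.coe_le_coe.2 hu.2)

theorem dist_torusBM {Ω : Type u} (W : ℝ≥0 → Ω → EuclideanSpace ℝ (Fin 2)) {x y : Torus} {v : ℂ}
    (hv : torusCover v = y - x) (t : ℝ≥0) (ω : Ω) :
    dist (torusBM W y t ω) x = latticeDist (planarPath W v t ω) := by
  have h : Torus.proj (W t ω) = torusCover ⟨W t ω 0, W t ω 1⟩ := by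
    ext i; fin_cases i <;> simp [torusCover, Torus.proj]
  rw [latticeDist, planarPath, torusCover_add, hv, dist_eq_norm, torusBM, h]
  congr 1
  abel

theorem hitTime_eq_entryTime {Ω : Type u} {X : ℝ≥0 → Ω → Torus} {B : Set Torus} {ω : Ω}
    {Z : ℝ≥0 → ℂ} {A : Set ℂ} (h : ∀ t, X t ω ∈ B ↔ Z t ∈ A) :
    hitTime X B ω = entryTime Z A := by
  simp only [hitTime, entryTime, h]

end PathComparison

/-! ### Mean hitting and exit times for open target sets. -/

namespace IsPlanarBrownian

variable {Ω : Type u} [MeasurableSpace Ω] {P : Measure Ω} [IsProbabilityMeasure P]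
  {W : ℝ≥0 → Ω → EuclideanSpace ℝ (Fin 2)}

theorem lintegral_entryTime_latticeDist_lt (hW : IsPlanarBrownian W P) {C : ℝ}
    (hC : ∀ z, 0 < latticeDist z →
      |SquareTheta.green z - Real.pi⁻¹ * Real.log (latticeDist z)| ≤ C)
    {r : ℝ} (hr : 0 < r) {v : ℂ} (hv : r ≤ latticeDist v) :
    ∫⁻ ω, entryTime (fun t => planarPath W v t ω) {z | latticeDist z < r} ∂P
      ≤ ENNReal.ofReal (Real.pi⁻¹ * Real.log (latticeDist v / r) + 2 * C) ∧
    ENNReal.ofReal (Real.pi⁻¹ * Real.log (latticeDist v / r) - 2 * C)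
      ≤ ∫⁻ ω, entryTime (fun t => planarPath W v t ω) {z | latticeDist z < r} ∂P := by
  -- Cutting off at `r / 2` makes `g` bounded, while circles of radius below `r / 2` centred outside
  -- the ball of radius `r` stay in `U`.
  set U : Set ℂ := {z | r / 2 < latticeDist z}
  have hU : IsOpen U := isOpen_lt continuous_const continuous_latticeDist
  set g : ℂ → ℝ := U.indicator (-SquareTheta.green)
  have hoff : ∀ z ∈ U, SquareTheta.OffLattice z := fun z hz =>
    offLattice_of_latticeDist_pos (lt_trans (by positivity) hz)
  have hgU : ∀ z ∈ U, g z = -SquareTheta.green z := fun z hz => Set.indicator_of_mem hz _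
  have hAU : ∀ z, z ∉ {z | latticeDist z < r} → z ∈ U := fun z hz =>
    lt_of_lt_of_le (half_lt_self hr) (not_lt.1 hz)
  have hpi : 0 < Real.pi⁻¹ := inv_pos.2 Real.pi_pos
  have hC0 : 0 ≤ C := (abs_nonneg _).trans (hC v (hr.trans_le hv))
  have hbounds := hW.lintegral_entryTime_bounds (v := v) (A := {z | latticeDist z < r})
    (isOpen_lt continuous_latticeDist continuous_const) (not_lt.2 hv) (g := g)
    (SquareTheta.measurable_green.neg.indicator hU.measurableSet)
    (M := C + Real.pi⁻¹ * |Real.log (r / 2)|) (fun z => ?_) (fun z hz => ?_) (ρ₀ := r / 2)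
    (by positivity) (fun z hz ρ hρ hρ' => ?_)
    (a := -(Real.pi⁻¹ * Real.log r) - C) (b := -(Real.pi⁻¹ * Real.log r) + C)
    (fun z hz => ?_) (fun z hz hz' => ?_)
  · rw [hgU v (hAU v (not_lt.2 hv))] at hbounds
    have h1 := abs_le.1 (hC v (hr.trans_le hv))
    rw [Real.log_div (hr.trans_le hv).ne' hr.ne']
    refine ⟨hbounds.1.trans (ENNReal.ofReal_le_ofReal ?_),
      (ENNReal.ofReal_le_ofReal ?_).trans hbounds.2⟩ <;> linarith [h1.1, h1.2]
  · by_cases hz : z ∈ U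
    · have hz0 : 0 < latticeDist z := lt_trans (by positivity) hz
      rw [hgU z hz, abs_neg]
      have h1 := abs_le.1 (hC z hz0)
      have h2 : |Real.log (latticeDist z)| ≤ |Real.log (r / 2)| := by
        have h3 := Real.log_le_log (by positivity) (le_of_lt hz)
        have h4 := Real.log_nonpos hz0.le (latticeDist_le_one z)
        rw [abs_of_nonpos h4, abs_of_nonpos (h3.trans h4)]
        linarith
      have h5 := abs_le.1 (by
        rw [abs_mul, abs_of_pos hpi]; exact mul_le_mul_of_nonneg_left h2 hpi.le :
          |Real.pi⁻¹ * Real.log (latticeDist z)| ≤ Real.pi⁻¹ * |Real.log (r / 2)|)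
      rw [abs_le]
      constructor <;> linarith [h1.1, h1.2, h5.1, h5.2]
    · simp only [g, Set.indicator_of_notMem hz, abs_zero]
      positivity
  · refine (SquareTheta.continuousAt_green (hoff z (hAU z hz))).neg.congr ?_
    filter_upwards [hU.mem_nhds (hAU z hz)] with w hw using (hgU w hw).symm
  · have hz1 : r ≤ latticeDist z := not_lt.1 hz
    have hball : ∀ w ∈ Metric.closedBall z ρ, w ∈ U := fun w hw => by
      have h1 := latticeDist_le_add w z
      rw [norm_sub_rev] at h1
      have h2 : ‖w - z‖ ≤ ρ := by simpa [dist_eq_norm] using hw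
      change r / 2 < latticeDist w
      linarith
    have e1 : Real.circleAverage g z ρ = Real.circleAverage (-SquareTheta.green) z ρ := by
      refine Real.circleAverage_congr_sphere fun w hw => ?_
      rw [abs_of_pos hρ] at hw
      exact hgU w (hball w (Metric.sphere_subset_closedBall hw))
    rw [e1, hgU z (hAU z hz), show (-SquareTheta.green) = (-1 : ℝ) • SquareTheta.green by
      ext; simp, Real.circleAverage_smul,
      SquareTheta.circleAverage_green hρ fun w hw => hoff w (hball w hw)]
    simp
    ring
  · have hz1 : r ≤ latticeDist z := not_lt.1 hz
    rw [hgU z (hAU z hz)]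
    have h1 := abs_le.1 (hC z (hr.trans_le hz1))
    have h2 := mul_le_mul_of_nonneg_left (Real.log_le_log hr hz1) hpi.le
    linarith [h1.1]
  · have hz1 : r ≤ latticeDist z := not_lt.1 hz
    have hz2 : latticeDist z ≤ r :=
      closure_minimal (s := {z | latticeDist z < r}) (t := {z | latticeDist z ≤ r})
        (fun w (hw : latticeDist w < r) => hw.le)
        (isClosed_le continuous_latticeDist continuous_const) hz'
    rw [hgU z (hAU z hz)]
    have h1 := abs_le.1 (hC z (hr.trans_le hz1))
    rw [le_antisymm hz2 hz1] at h1
    linarith [h1.2]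

theorem lintegral_entryTime_norm_gt (hW : IsPlanarBrownian W P) {v : ℂ} {s : ℝ} (hv : ‖v‖ ≤ s) :
    ∫⁻ ω, entryTime (fun t => planarPath W v t ω) {z | s < ‖z‖} ∂P
      = ENNReal.ofReal ((s ^ 2 - ‖v‖ ^ 2) / 2) := by
  have hs : 0 ≤ s := (norm_nonneg v).trans hv
  -- The cutoff bounds `g` and leaves room for circles of radius below `1` around points with `‖z‖ ≤
  -- s`.
  set U : Set ℂ := {z | ‖z‖ < s + 1}
  have hU : IsOpen U := isOpen_lt continuous_norm continuous_const
  set q : ℂ → ℝ := fun z => ‖z‖ ^ 2 / 2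
  have hq : Continuous q := by fun_prop
  set g : ℂ → ℝ := U.indicator q
  have hgU : ∀ z ∈ U, g z = q z := fun z hz => Set.indicator_of_mem hz _
  have hAU : ∀ z, z ∉ {z : ℂ | s < ‖z‖} → z ∈ U := fun z hz =>
    lt_of_le_of_lt (not_lt.1 hz) (lt_add_one s)
  have hbounds := hW.lintegral_entryTime_bounds (v := v) (A := {z | s < ‖z‖})
    (isOpen_lt continuous_const continuous_norm) (not_lt.2 hv) (g := g)
    (hq.measurable.indicator hU.measurableSet)
    (M := (s + 1) ^ 2 / 2) (fun z => ?_) (fun z hz => ?_) (ρ₀ := 1)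
    one_pos (fun z hz ρ hρ hρ' => ?_) (a := s ^ 2 / 2) (b := s ^ 2 / 2)
    (fun z hz => ?_) (fun z hz hz' => ?_)
  · rw [hgU v (hAU v (not_lt.2 hv)), ← sub_div] at hbounds
    exact le_antisymm hbounds.1 hbounds.2
  · by_cases hz : z ∈ U
    · rw [hgU z hz, abs_of_nonneg (by positivity)]
      have : ‖z‖ ≤ s + 1 := le_of_lt hz
      simp only [q]
      gcongr
    · simp only [g, Set.indicator_of_notMem hz, abs_zero]
      positivity
  · refine hq.continuousAt.congr ?_
    filter_upwards [hU.mem_nhds (hAU z hz)] with w hw using (hgU w hw).symm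
  · have hz1 : ‖z‖ ≤ s := not_lt.1 hz
    have e1 : Real.circleAverage g z ρ = Real.circleAverage
        ((2 : ℝ)⁻¹ • ((fun w : ℂ => w.re ^ 2) + fun w => w.im ^ 2)) z ρ := by
      refine Real.circleAverage_congr_sphere fun w hw => ?_
      rw [abs_of_pos hρ, mem_sphere_iff_norm] at hw
      have h1 : ‖w‖ ≤ ‖z‖ + ‖w - z‖ := by simpa using norm_add_le z (w - z)
      have hw' : w ∈ U := lt_of_le_of_lt h1 (by linarith)
      rw [hgU w hw']
      simp only [q, ← Complex.normSq_eq_norm_sq, Complex.normSq_apply, Pi.smul_apply, Pi.add_apply,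
        smul_eq_mul]
      ring
    rw [e1, Real.circleAverage_smul, Real.circleAverage_add, circleAverage_re_sq,
      circleAverage_im_sq, hgU z (hAU z hz)]
    · simp only [q, ← Complex.normSq_eq_norm_sq, Complex.normSq_apply, smul_eq_mul]
      ring
    · exact (Continuous.continuousOn (by fun_prop)).circleIntegrable'
    · exact (Continuous.continuousOn (by fun_prop)).circleIntegrable'
  · rw [hgU z (hAU z hz)]
    have : ‖z‖ ≤ s := not_lt.1 hz
    simp only [q]
    gcongr
  · rw [hgU z (hAU z hz)]
    have : s ≤ ‖z‖ :=
      closure_minimal (s := {z : ℂ | s < ‖z‖}) (t := {z : ℂ | s ≤ ‖z‖})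
        (fun w (hw : s < ‖w‖) => hw.le)
        (isClosed_le continuous_const continuous_norm) hz'
    simp only [q]
    gcongr

theorem lintegral_entryTime_latticeDist_gt (hW : IsPlanarBrownian W P) {v : ℂ} {s : ℝ}
    (hv : ‖v‖ ≤ s) (hs : s < 1 / 2) :
    ∫⁻ ω, entryTime (fun t => planarPath W v t ω) {z | s < latticeDist z} ∂P
      = ENNReal.ofReal ((s ^ 2 - ‖v‖ ^ 2) / 2) := by
  rw [← hW.lintegral_entryTime_norm_gt hv]
  refine lintegral_congr_ae ?_
  filter_upwards [hW.ae_continuous_planarPath v] with ω hω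
  exact entryTime_latticeDist_gt hω.1 hs (by rw [hω.2]; exact hv)

end IsPlanarBrownian

/-! ### Passage to closed target sets. -/

namespace IsPlanarBrownian

variable {Ω : Type u} [MeasurableSpace Ω] {P : Measure Ω} [IsProbabilityMeasure P]
  {W : ℝ≥0 → Ω → EuclideanSpace ℝ (Fin 2)}

theorem aemeasurable_entryTime_latticeDist_le (hW : IsPlanarBrownian W P) (v : ℂ) (r : ℝ) :
    AEMeasurable (fun ω => entryTime (fun t => planarPath W v t ω) {z | latticeDist z ≤ r}) P := by
  refine (AEMeasurable.iSup fun n : ℕ => hW.aemeasurable_entryTime v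
    (A := {z | latticeDist z < r + 1 / ((n : ℝ) + 1)})
    (isOpen_lt continuous_latticeDist continuous_const)).congr ?_
  filter_upwards [hW.ae_continuous_planarPath v] with ω hω
  exact (entryTime_le_eq_iSup hω.1 continuous_latticeDist r).symm

/-- The time lies between the exit times `τ (s n)`, with `s n` increasing to `r`, and `τ r`. Their
means converge to the finite mean of `τ r`, so `⨆ n, τ (s n)` and `τ r` agree almost surely, and the
time between them is measurable up to a null set. -/
theorem lintegral_entryTime_latticeDist_ge (hW : IsPlanarBrownian W P) {v : ℂ} {r : ℝ}
    (hvr : ‖v‖ < r) (hr : r < 1 / 2) :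
    AEMeasurable (fun ω => entryTime (fun t => planarPath W v t ω) {z | r ≤ latticeDist z}) P ∧
    ∫⁻ ω, entryTime (fun t => planarPath W v t ω) {z | r ≤ latticeDist z} ∂P
      = ENNReal.ofReal ((r ^ 2 - ‖v‖ ^ 2) / 2) := by
  let τ : ℝ → Ω → ℝ≥0∞ := fun s ω =>
    entryTime (fun t => planarPath W v t ω) {z | s < latticeDist z}
  have hτm : ∀ s, AEMeasurable (τ s) P := fun s =>
    hW.aemeasurable_entryTime v (isOpen_lt continuous_const continuous_latticeDist)
  have hτ : ∀ s, ‖v‖ ≤ s → s < 1 / 2 → ∫⁻ ω, τ s ω ∂P = ENNReal.ofReal ((s ^ 2 - ‖v‖ ^ 2) / 2) :=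
    fun s h1 h2 => hW.lintegral_entryTime_latticeDist_gt h1 h2
  let s : ℕ → ℝ := fun n => r - (r - ‖v‖) / ((n + 1 : ℕ) : ℝ)
  have hs1 : ∀ n, ‖v‖ ≤ s n := fun n => by
    have : (r - ‖v‖) / ((n + 1 : ℕ) : ℝ) ≤ r - ‖v‖ :=
      div_le_self (by linarith) (by exact_mod_cast Nat.succ_pos n)
    simp only [s]
    linarith
  have hs2 : ∀ n, s n < r := fun n => sub_lt_self _ (div_pos (by linarith) (by positivity))
  have hslim : Tendsto s atTop (𝓝 r) := by
    have := (tendsto_const_nhds (x := r)).sub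
      ((tendsto_const_div_atTop_nhds_zero_nat (r - ‖v‖)).comp (tendsto_add_atTop_nat 1))
    rwa [sub_zero] at this
  let σ : Ω → ℝ≥0∞ := fun ω => entryTime (fun t => planarPath W v t ω) {z | r ≤ latticeDist z}
  let L : Ω → ℝ≥0∞ := fun ω => ⨆ n, τ (s n) ω
  have hLσ : ∀ ω, L ω ≤ σ ω := fun ω => iSup_le fun n => entryTime_anti fun z hz =>
    show s n < latticeDist z from (hs2 n).trans_le hz
  have hστ : ∀ ω, σ ω ≤ τ r ω := fun ω => entryTime_anti fun z (hz : r < latticeDist z) =>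
    show r ≤ latticeDist z from hz.le
  have hle : ∫⁻ ω, τ r ω ∂P ≤ ∫⁻ ω, L ω ∂P := by
    have h1 : ∀ n, ENNReal.ofReal ((s n ^ 2 - ‖v‖ ^ 2) / 2) ≤ ∫⁻ ω, L ω ∂P := fun n => by
      rw [← hτ _ (hs1 n) ((hs2 n).trans hr)]
      exact lintegral_mono fun ω => le_iSup (fun n => τ (s n) ω) n
    rw [hτ r hvr.le hr]
    have h2 : Tendsto (fun n => (s n ^ 2 - ‖v‖ ^ 2) / 2) atTop (𝓝 ((r ^ 2 - ‖v‖ ^ 2) / 2)) :=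
      ((hslim.pow 2).sub_const _).div_const 2
    exact le_of_tendsto' ((ENNReal.continuous_ofReal.tendsto _).comp h2) h1
  have hLτ : L =ᵐ[P] τ r := by
    refine ae_eq_of_ae_le_of_lintegral_le (ae_of_all _ fun ω => (hLσ ω).trans (hστ ω)) ?_
      (hτm r) hle
    refine ne_top_of_le_ne_top ?_ (lintegral_mono fun ω => (hLσ ω).trans (hστ ω))
    rw [hτ r hvr.le hr]
    exact ENNReal.ofReal_ne_top
  have hσ : σ =ᵐ[P] τ r := by
    filter_upwards [hLτ] with ω hω
    exact le_antisymm (hστ ω) (hω ▸ hLσ ω)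
  exact ⟨(hτm r).congr hσ.symm, (lintegral_congr_ae hσ).trans (hτ r hvr.le hr)⟩

end IsPlanarBrownian

end

/-! ### The two estimates on the torus. -/

theorem proposition4 :
    (∃ C : ℝ, 0 < C ∧
      ∀ (Ω : Type u) [MeasurableSpace Ω] (P : Measure Ω) [IsProbabilityMeasure P]
        (W : ℝ≥0 → Ω → EuclideanSpace ℝ (Fin 2)), IsPlanarBrownian W P →
      ∀ (x : Torus) (r : ℝ), 0 < r →
      ∀ B : Set Torus, (B = Metric.ball x r ∨ B = Metric.closedBall x r) →
      ∀ y : Torus, y ∉ B →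
        AEMeasurable (hitTime (torusBM W y) B) P ∧
        ∫⁻ ω, hitTime (torusBM W y) B ω ∂P ≠ ∞ ∧
        |(∫⁻ ω, hitTime (torusBM W y) B ω ∂P).toReal
            - 1 / Real.pi * Real.log (dist x y / r)| ≤ C) ∧
    (∀ (Ω : Type u) [MeasurableSpace Ω] (P : Measure Ω) [IsProbabilityMeasure P]
        (W : ℝ≥0 → Ω → EuclideanSpace ℝ (Fin 2)), IsPlanarBrownian W P →
      ∀ (x : Torus) (r : ℝ), 0 < r → r < 1 / 2 →
      ∀ B : Set Torus, (B = Metric.ball x r ∨ B = Metric.closedBall x r) →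
      ∀ y : Torus, y ∈ B →
        AEMeasurable (hitTime (torusBM W y) Bᶜ) P ∧
        ∫⁻ ω, hitTime (torusBM W y) Bᶜ ω ∂P
          = ENNReal.ofReal ((r ^ 2 - dist x y ^ 2) / 2)) := by
  constructor
  · obtain ⟨C, hC0, hC⟩ := exists_abs_green_sub_log_latticeDist_le
    -- The Green function accounts for `2C`; the extra `1` absorbs the loss `π⁻¹ log 2` for closed
    -- balls.
    refine ⟨2 * C + 1, by positivity, fun Ω _ P _ W hW x r hr B hB y hy => ?_⟩
    obtain ⟨v, -, hv⟩ := exists_mem_unitSquare_torusCover_eq (y - x)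
    have hd : dist y x = latticeDist v := by rw [dist_eq_norm, ← hv]; rfl
    have hlog2 : Real.pi⁻¹ * Real.log 2 ≤ 1 := by
      have h1 : Real.pi⁻¹ ≤ 1 := inv_le_one_of_one_le₀ (by linarith [Real.pi_gt_three])
      have h2 : Real.log 2 ≤ 1 := by linarith [Real.log_two_lt_d9]
      exact mul_le_one₀ h1 (Real.log_nonneg (by norm_num)) h2
    have conclude : ∀ E : ℝ≥0∞,
        E ≤ ENNReal.ofReal (Real.pi⁻¹ * Real.log (latticeDist v / r) + 2 * C) →
        ENNReal.ofReal (Real.pi⁻¹ * Real.log (latticeDist v / r) - 2 * C - 1) ≤ E →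
        r ≤ latticeDist v →
        E ≠ ∞ ∧ |E.toReal - 1 / Real.pi * Real.log (dist x y / r)| ≤ 2 * C + 1 := by
      intro E h1 h2 h3
      have hE : E ≠ ∞ := ne_top_of_le_ne_top ENNReal.ofReal_ne_top h1
      refine ⟨hE, ?_⟩
      have h4 : 0 ≤ Real.pi⁻¹ * Real.log (latticeDist v / r) :=
        mul_nonneg (inv_nonneg.2 Real.pi_pos.le) (Real.log_nonneg ((one_le_div hr).2 h3))
      have h5 := ENNReal.toReal_le_of_le_ofReal (by positivity) h1
      have h6 := (ENNReal.ofReal_le_iff_le_toReal hE).1 h2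
      rw [dist_comm, hd, one_div, abs_le]
      constructor <;> linarith
    rcases hB with rfl | rfl
    · have hτ : ∀ ω, hitTime (torusBM W y) (Metric.ball x r) ω
          = entryTime (fun t => planarPath W v t ω) {z | latticeDist z < r} := fun ω =>
        hitTime_eq_entryTime fun t => by
          rw [Metric.mem_ball, dist_torusBM W hv]; rfl
      have hy' : r ≤ latticeDist v := by rw [← hd]; exact not_lt.1 hy
      simp only [funext hτ]
      obtain ⟨h1, h2⟩ := hW.lintegral_entryTime_latticeDist_lt hC hr hy'
      exact ⟨hW.aemeasurable_entryTime v (isOpen_lt continuous_latticeDist continuous_const),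
        conclude _ h1 ((ENNReal.ofReal_le_ofReal (by linarith)).trans h2) hy'⟩
    · have hτ : ∀ ω, hitTime (torusBM W y) (Metric.closedBall x r) ω
          = entryTime (fun t => planarPath W v t ω) {z | latticeDist z ≤ r} := fun ω =>
        hitTime_eq_entryTime fun t => by
          rw [Metric.mem_closedBall, dist_torusBM W hv]; rfl
      have hy' : r < latticeDist v := by rw [← hd]; exact not_le.1 hy
      simp only [funext hτ]
      obtain ⟨h1, -⟩ := hW.lintegral_entryTime_latticeDist_lt hC hr hy'.le
      -- The closed ball lies in the open ball of radius `r'`, whose hitting time is no later. The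
      -- cap `latticeDist v` keeps the start outside it, and `r' ≤ 2 * r` limits the loss to `π⁻¹
      -- log 2`.
      set r' := min (2 * r) (latticeDist v)
      have hr1 : r < r' := lt_min (by linarith) hy'
      obtain ⟨-, h2⟩ := hW.lintegral_entryTime_latticeDist_lt hC (hr.trans hr1) (min_le_right _ _)
      refine ⟨hW.aemeasurable_entryTime_latticeDist_le v r, conclude _ ?_ ?_ hy'.le⟩
      · refine (lintegral_mono fun ω => entryTime_anti fun z hz => ?_).trans h1
        have hz' : latticeDist z < r := hz
        exact hz'.le
      · refine le_trans (ENNReal.ofReal_le_ofReal ?_) (h2.trans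
          (lintegral_mono fun ω => entryTime_anti fun z hz => ?_))
        · have hd0 : 0 < latticeDist v := hr.trans hy'
          have e : Real.log (latticeDist v / r') ≥ Real.log (latticeDist v / r) - Real.log 2 := by
            rw [Real.log_div hd0.ne' (hr.trans hr1).ne', Real.log_div hd0.ne' hr.ne']
            have := Real.log_le_log (hr.trans hr1) (min_le_left (2 * r) (latticeDist v))
            rw [Real.log_mul two_ne_zero hr.ne'] at this
            linarith
          have := mul_le_mul_of_nonneg_left e (inv_nonneg.2 Real.pi_pos.le)
          rw [mul_sub] at this
          linarith
        · have hz' : latticeDist z ≤ r := hz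
          exact hz'.trans_lt hr1
  · intro Ω _ P _ W hW x r hr hr2 B hB y hy
    obtain ⟨v, hvsq, hv⟩ := exists_mem_unitSquare_torusCover_eq (y - x)
    have hd : dist y x = latticeDist v := by rw [dist_eq_norm, ← hv]; rfl
    have hvn := latticeDist_eq_norm_of_mem_unitSquare hvsq
    rw [dist_comm x y, hd, hvn]
    rcases hB with rfl | rfl
    · have hτ : ∀ ω, hitTime (torusBM W y) (Metric.ball x r)ᶜ ω
          = entryTime (fun t => planarPath W v t ω) {z | r ≤ latticeDist z} := fun ω =>
        hitTime_eq_entryTime fun t => by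
          rw [Set.mem_compl_iff, Metric.mem_ball, dist_torusBM W hv, not_lt]; rfl
      simp only [funext hτ]
      exact hW.lintegral_entryTime_latticeDist_ge (by rw [← hvn, ← hd]; exact hy) hr2
    · have hτ : ∀ ω, hitTime (torusBM W y) (Metric.closedBall x r)ᶜ ω
          = entryTime (fun t => planarPath W v t ω) {z | r < latticeDist z} := fun ω =>
        hitTime_eq_entryTime fun t => by
          rw [Set.mem_compl_iff, Metric.mem_closedBall, dist_torusBM W hv, not_le]; rfl
      simp only [funext hτ]
      exact ⟨hW.aemeasurable_entryTime v (isOpen_lt continuous_const continuous_latticeDist),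
        hW.lintegral_entryTime_latticeDist_gt (by rw [← hvn, ← hd]; exact hy) hr2⟩
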